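/- **Utility model.** Let $(b_i)_{i\ge 1}$ be nonnegative reals with $b_{i+1}<b_i$ (the benefit from a node at distance $i$), $c$ the cost of maintaining a link, $c_0$ the network entry factor, and $0\le\gamma<1$. In a network (finite simple graph) with node set $N$, let $l(j,w)$ be the distance of connected nodes $j,w$ (unconnected nodes give no benefit), $d_j$ the degree of $j$, $E(y,z)$ the set of nodes other than $y,z$ that lie on every path joining $y$ and $z$ (empty if $y,z$ are not connected), and $e(y,z)=|E(y,z)|$. The utility of $j$ is $$u_j=d_j(b_1-c)+\sum_{w:\,l(j,w)>1}b_{l(j,w)}-\sum_{w:\,E(j,w)\ne\emptyset}\gamma\, b_{l(j,w)}+\sum_{\{y,z\}:\,j\in E(y,z)}\frac{\gamma}{e(y,z)}\,2b_{l(y,z)} ,$$ and a newly entering node that creates its first link with a node $t$ pays in addition the fee $c_0 d_t$, where $d_t$ is the degree of $t$ before the link is created. A network $g$ is pairwise stable if no node strictly gains by deleting one of its links, and, for any two unlinked nodes $i,j$, $u_i(g\cup\{ij\})>u_i(g)$ implies $u_j(g\cup\{ij\})<u_j(g)$. **Formation process.** The process starts with one node. When the network is pairwise stable and has fewer than $\sigma$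 nodes, a new node considers entering: among the existing nodes whose utility does not decrease by a link with it, it links to one that maximizes its own utility (fee included), provided that this is strictly positive; otherwise it stays out. After an entry, nodes are chosen one at a time, in any order. A chosen node may delete one of its links or create one link with a non-neighbor whose utility does not decrease; it makes an alteration that maximizes its utility if this strictly improves on the status quo, and otherwise changes nothing. This goes on until the network is pairwise stable. A *2-star* is a graph consisting of two linked centers, in which every other node is a leaf linked to exactly one of the centers, and the numbers of leaves of the two centers differ by at most one. **Theorem.** Let $\sigma$ be the upper bound on the number of nodes and $\lambda=\lceil \frac{\sigma}{2}-1\rceil(2b_2-b_3)$. Suppose that $$(1-\gamma)(b_2-b_3)<c_0<(1-\gamma)(b_2-b_4)$$ and that either (i) $\gamma<\min\left\{\frac{b_2-b_3}{\lambda-b_3},\frac{b_3}{b_2+b_3}\right\}$ and $b_1-b_3+\gamma(b_2+b_3)\le c<b_1$, or (ii) $\frac{b_2-b_3}{\lambda-b_3}\le\gamma<\min\left\{\frac{b_2}{\lambda+b_2},\frac{b_3}{b_2+b_3}\right\}$ and $b_1-b_2+\gamma b_2+\gamma\lambda<c<b_1$. Then the resulting topology is a 2-star. That is, for every order in which the nodes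 get to move and every choice among equally good best responses: as long as the network has fewer than $\sigma$ nodes a new node enters; after each entry the network reaches a pairwise stable state after finitely many alterations; and for every $n$ with $2\le n\le\sigma$ the pairwise stable network formed on $n$ nodes exists and is a 2-star. -/

import Mathlib

namespace NetworkFormation

open Finset

/-- The parameters of the utility model: `b i` is the benefit obtained from a node at distance
`i ≥ 1` in absence of rents (`b 0` is never used), `c` the cost of maintaining a link, `c₀` the
network entry factor, `γ` the fraction of indirect benefits paid to the essential nodes. -/
structure Params where
  b : ℕ → ℝ
  c : ℝ
  c₀ : ℝ
  γ : ℝ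

section Utility

variable {V : Type*} [Fintype V]

open Classical in
/-- `E(y,z)`: the intermediaries that lie on every path joining `y` and `z`, when `y` and `z` are
connected (it is empty when they are not, when they are adjacent, and when they are equal). -/
noncomputable def essential (G : SimpleGraph V) (y z : V) : Finset V :=
  univ.filter fun x =>
    x ≠ y ∧ x ≠ z ∧ G.Reachable y z ∧ ∀ p : G.Walk y z, p.IsPath → x ∈ p.support

open Classical in
/-- The utility of node `j` in the network `G`, without the entry fee: direct benefits minus link
costs, plus indirect benefits, minus intermediation rents, plus bridging benefits.
Unconnected nodes have `G.dist = 0`, so they give no indirect benefit. The bridging benefits are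
summed over unordered pairs `{y, z}`, that is, half of the sum over ordered pairs. -/
noncomputable def utility (P : Params) (G : SimpleGraph V) (j : V) : ℝ :=
  (G.degree j : ℝ) * (P.b 1 - P.c)
    + ∑ w ∈ univ.filter (fun w => 1 < G.dist j w), P.b (G.dist j w)
    - ∑ w ∈ univ.filter (fun w => (essential G j w).Nonempty), P.γ * P.b (G.dist j w)
    + (1 / 2) * ∑ q ∈ univ.filter (fun q : V × V => j ∈ essential G q.1 q.2),
        P.γ / ((essential G q.1 q.2).card : ℝ) * (2 * P.b (G.dist q.1 q.2))

/-- The network `G` after the link between `i` and `j` is added. -/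
def addLink (G : SimpleGraph V) (i j : V) : SimpleGraph V := G ⊔ SimpleGraph.edge i j

/-- The network `G` after the link between `i` and `j` is deleted. -/
def deleteLink (G : SimpleGraph V) (i j : V) : SimpleGraph V := G.deleteEdges {s(i, j)}

/-- Pairwise stability: no node gains by deleting one of its links, and whenever one of two
unlinked nodes strictly gains from their mutual link, the other one strictly loses. -/
def PairwiseStable (P : Params) (G : SimpleGraph V) : Prop :=
  (∀ i j, G.Adj i j → utility P (deleteLink G i j) i ≤ utility P G i) ∧
  (∀ i j, i ≠ j → ¬ G.Adj i j → utility P G i < utility P (addLink G i j) i →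
    utility P (addLink G i j) j < utility P G j)

/-- The alterations available to node `j` in the network `G`: deleting one of its links, or creating
a link with a node that is not its neighbor and whose utility does not decrease by it. -/
def Alteration (P : Params) (G : SimpleGraph V) (j : V) (G' : SimpleGraph V) : Prop :=
  (∃ w, G.Adj j w ∧ G' = deleteLink G j w) ∨
  (∃ w, j ≠ w ∧ ¬ G.Adj j w ∧ utility P G w ≤ utility P (addLink G j w) w ∧ G' = addLink G j w)

/-- The node `j` gets to move in `G`, and its myopic best response is to alter one link, which turns
the network into `G'`: the alteration strictly improves on the status quo and is at least as good as
every other available alteration. -/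
def BestResponse (P : Params) (j : V) (G G' : SimpleGraph V) : Prop :=
  Alteration P G j G' ∧ utility P G j < utility P G' j ∧
    ∀ G'', Alteration P G j G'' → utility P G'' j ≤ utility P G' j

/-- One change of the network, by a best response of some node. -/
def Move (P : Params) (G G' : SimpleGraph V) : Prop := ∃ j, BestResponse P j G G'

/-- `G` is a 2-star: two linked centers `C₁` and `C₂`; every other node is a leaf, linked to exactly
one of the two centers and to nothing else; the numbers of leaves of the two centers differ by at
most one. -/
def IsTwoStar (G : SimpleGraph V) : Prop :=
  ∃ (C₁ C₂ : V) (L₁ L₂ : Finset V),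
    C₁ ≠ C₂ ∧ C₁ ∉ L₁ ∧ C₁ ∉ L₂ ∧ C₂ ∉ L₁ ∧ C₂ ∉ L₂ ∧ Disjoint L₁ L₂ ∧
    (∀ v, v = C₁ ∨ v = C₂ ∨ v ∈ L₁ ∨ v ∈ L₂) ∧
    L₁.card ≤ L₂.card + 1 ∧ L₂.card ≤ L₁.card + 1 ∧
    G = SimpleGraph.fromRel
      (fun x y => (x = C₁ ∧ y = C₂) ∨ (x = C₁ ∧ y ∈ L₁) ∨ (x = C₂ ∧ y ∈ L₂))

end Utility

/-- The network on `n + 1` nodes in which the new node `Fin.last n` has entered the network `G` by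
creating its first link with the node `t`. -/
def enter {n : ℕ} (G : SimpleGraph (Fin n)) (t : Fin n) : SimpleGraph (Fin (n + 1)) :=
  addLink (G.map Fin.castSuccEmb) (Fin.last n) t.castSucc

open Classical in
/-- The utility of the new node when it enters by linking to `t`; it pays the entry fee, `c₀` times
the degree of `t`. -/
noncomputable def entryUtility (P : Params) {n : ℕ} (G : SimpleGraph (Fin n)) (t : Fin n) : ℝ :=
  utility P (enter G t) (Fin.last n) - P.c₀ * (G.degree t : ℝ)

/-- The node `t` accepts the link of the new node: its utility does not decrease. -/
def Accepts (P : Params) {n : ℕ} (G : SimpleGraph (Fin n)) (t : Fin n) : Prop :=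
  utility P G t ≤ utility P (enter G t) t.castSucc

/-- It is a myopic best response of the new node to enter by linking to `t`: the link is accepted,
the new node is strictly better off than outside (where its utility is `0`), and no other accepted
link is better for it. -/
def EntryChoice (P : Params) {n : ℕ} (G : SimpleGraph (Fin n)) (t : Fin n) : Prop :=
  Accepts P G t ∧ 0 < entryUtility P G t ∧
    ∀ t', Accepts P G t' → entryUtility P G t' ≤ entryUtility P G t

/-- `Formed P n G`: for some order in which the nodes get to move, the recursive formation process
results in the pairwise stable network `G` on `n` nodes. The process starts with one node; a new
node enters a pairwise stable network by a best response, and then the network evolves by best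
responses of arbitrarily chosen nodes until it is pairwise stable. -/
inductive Formed (P : Params) : (n : ℕ) → SimpleGraph (Fin n) → Prop
  | one : Formed P 1 ⊥
  | next {n : ℕ} {G : SimpleGraph (Fin n)} {t : Fin n} {G' : SimpleGraph (Fin (n + 1))} :
      Formed P n G → EntryChoice P G t → Relation.ReflTransGen (Move P) (enter G t) G' →
      PairwiseStable P G' → Formed P (n + 1) G'

end NetworkFormation

namespace NetworkFormation

open Finset

theorem reachable_mem_of_closed {V : Type*} {G : SimpleGraph V} {y z : V} (S : Set V)
    (hS : ∀ u ∈ S, ∀ v, G.Adj u v → v ∈ S)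
    (hy : y ∈ S) (hr : G.Reachable y z) : z ∈ S := by
  obtain ⟨p⟩ := hr
  induction p with
  | nil => exact hy
  | cons h p ih => exact ih (hS _ hy _ h)

theorem dist_map_of_acyclic {V W : Type*} {G : SimpleGraph V} {G' : SimpleGraph W} {y z : V}
    (hG' : G'.IsAcyclic) (f : G →g G') (hf : Function.Injective f)
    (hr : G.Reachable y z) : G'.dist (f y) (f z) = G.dist y z := by
  obtain ⟨p, hp, hl⟩ := hr.exists_path_of_dist
  obtain ⟨q, hq, hl'⟩ := (hr.map f).exists_path_of_dist
  have := congrArg Subtype.val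
      ((hG'.subsingleton_path _ _).elim ⟨p.map f, hp.map hf⟩ ⟨q, hq⟩)
  simp only at this
  rw [← hl, ← hl', ← this, SimpleGraph.Walk.length_map]

section Essential

variable {V : Type*} [Fintype V] {G G' : SimpleGraph V} {x y z : V}

theorem mem_essential : x ∈ essential G y z ↔
    x ≠ y ∧ x ≠ z ∧ G.Reachable y z ∧ ∀ p : G.Walk y z, p.IsPath → x ∈ p.support := by
  simp [essential]

theorem mem_essential_iff_walk : x ∈ essential G y z ↔
    x ≠ y ∧ x ≠ z ∧ G.Reachable y z ∧ ∀ p : G.Walk y z, x ∈ p.support := by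
  classical
  rw [mem_essential]
  refine and_congr_right fun _ => and_congr_right fun _ => and_congr_right fun _ =>
    ⟨fun h p => ?_, fun h p _ => h p⟩
  exact p.support_bypass_subset_support (h _ p.bypass_isPath)

theorem essential_comm : essential G y z = essential G z y := by
  ext x
  simp only [mem_essential_iff_walk]
  constructor
  · rintro ⟨h1, h2, h3, h4⟩
    exact ⟨h2, h1, h3.symm, fun p => by simpa using h4 p.reverse⟩
  · rintro ⟨h1, h2, h3, h4⟩
    exact ⟨h2, h1, h3.symm, fun p => by simpa using h4 p.reverse⟩

theorem essential_self : essential G y y = ∅ := by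
  ext x
  simp only [mem_essential_iff_walk, notMem_empty, iff_false]
  rintro ⟨h1, -, -, h4⟩
  simpa [h1] using h4 .nil

theorem essential_of_adj (h : G.Adj y z) : essential G y z = ∅ := by
  ext x
  simp only [mem_essential_iff_walk, notMem_empty, iff_false]
  rintro ⟨h1, h2, -, h4⟩
  simpa [h1, h2] using h4 h.toWalk

/-- Adding links keeps a connected pair from gaining essential nodes. -/
theorem essential_anti (h : G ≤ G') (hr : G.Reachable y z) :
    essential G' y z ⊆ essential G y z := by
  intro x hx
  rw [mem_essential_iff_walk] at hx ⊢
  refine ⟨hx.1, hx.2.1, hr, fun p => ?_⟩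
  simpa using hx.2.2.2 (p.mapLe h)

/-- A set that can be left only through `x` makes `x` essential. -/
theorem mem_essential_of_cut (S : Set V) (hy : y ∈ S) (hz : z ∉ S) (hxy : x ∉ S) (hxz : x ≠ z)
    (hr : G.Reachable y z) (hS : ∀ u ∈ S, ∀ v ∉ S, G.Adj u v → v = x) :
    x ∈ essential G y z := by
  rw [mem_essential_iff_walk]
  refine ⟨fun h => hxy (h ▸ hy), hxz, hr, fun p => ?_⟩
  clear hr hxz hxy
  induction p with
  | nil => exact absurd hy hz
  | @cons u v w h p ih =>
    by_cases hv : v ∈ S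
    · exact List.mem_cons_of_mem _ (ih hv hz)
    · have := hS u hy v hv h
      subst this
      simp

/-- The only neighbor of a node is essential for that node and any third node. -/
theorem mem_essential_of_pendant (hp : ∀ u, G.Adj u z → u = x) (hxy : x ≠ y) (hxz : x ≠ z)
    (hyz : y ≠ z) (hr : G.Reachable y z) : x ∈ essential G y z := by
  refine mem_essential_of_cut {v | v ≠ z ∧ v ≠ x} ⟨hyz, hxy.symm⟩ (by simp) (by simp) hxz hr ?_
  rintro u ⟨h1, h2⟩ v hv huv
  by_contra hvx
  have hvz : v = z := by
    by_contra hvz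
    exact hv ⟨hvz, hvx⟩
  subst hvz
  exact h2 (hp u huv)

theorem mem_essential_of_pendant_left (hp : ∀ u, G.Adj u y → u = x) (hxy : x ≠ y) (hxz : x ≠ z)
    (hyz : y ≠ z) (hr : G.Reachable y z) : x ∈ essential G y z := by
  rw [essential_comm]
  exact mem_essential_of_pendant hp hxz hxy hyz.symm hr.symm

/-- The essential nodes lie strictly inside a shortest path. -/
theorem card_essential_lt_dist (hr : G.Reachable y z) (hyz : y ≠ z) :
    (essential G y z).card + 1 ≤ G.dist y z := by
  classical
  obtain ⟨p, hp, hl⟩ := hr.exists_path_of_dist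
  have hsub : insert y (insert z (essential G y z)) ⊆ p.support.toFinset := by
    intro x hx
    simp only [mem_insert] at hx
    rw [List.mem_toFinset]
    rcases hx with rfl | rfl | hx
    · exact p.start_mem_support
    · exact p.end_mem_support
    · exact (mem_essential.1 hx).2.2.2 p hp
  have h := card_le_card hsub
  have hz : z ∉ essential G y z := fun h => (mem_essential.1 h).2.1 rfl
  have hy : y ∉ insert z (essential G y z) := by
    simp only [mem_insert, not_or]
    exact ⟨hyz, fun h => (mem_essential.1 h).1 rfl⟩
  rw [card_insert_of_notMem hy, card_insert_of_notMem hz] at h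
  have h2 := List.toFinset_card_le p.support
  rw [SimpleGraph.Walk.length_support] at h2
  omega

theorem two_le_dist_of_mem_essential (h : x ∈ essential G y z) : 2 ≤ G.dist y z := by
  have hyz : y ≠ z := by
    rintro rfl
    simp [essential_self] at h
  have h1 := card_essential_lt_dist (mem_essential.1 h).2.2.1 hyz
  have h2 := card_pos.2 ⟨x, h⟩
  omega

end Essential

section Terms

variable {V : Type*} [Fintype V]

open Classical in
/-- The indirect benefit that `j` obtains from `w`, net of the rents. -/
noncomputable def indirectTerm (P : Params) (G : SimpleGraph V) (j w : V) : ℝ :=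
  (if 1 < G.dist j w then P.b (G.dist j w) else 0)
    - if (essential G j w).Nonempty then P.γ * P.b (G.dist j w) else 0

open Classical in
/-- The bridging benefit that `j` obtains from the ordered pair `(y, z)`. -/
noncomputable def bridgeTerm (P : Params) (G : SimpleGraph V) (j y z : V) : ℝ :=
  if j ∈ essential G y z then
    P.γ / ((essential G y z).card : ℝ) * (2 * P.b (G.dist y z)) else 0

open Classical in
noncomputable def linkCount (G : SimpleGraph V) (j : V) : ℕ := #{w | G.Adj j w}

theorem degree_eq_linkCount (G : SimpleGraph V) (j : V) [Fintype (G.neighborSet j)] :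
    G.degree j = linkCount G j := by
  classical
  rw [linkCount, ← SimpleGraph.card_neighborFinset_eq_degree]
  congr 1
  ext w
  simp

theorem utility_eq (P : Params) (G : SimpleGraph V) (j : V) :
    utility P G j = linkCount G j * (P.b 1 - P.c) + ∑ w, indirectTerm P G j w
      + (1 / 2) * ∑ y, ∑ z, bridgeTerm P G j y z := by
  classical
  unfold utility indirectTerm bridgeTerm
  rw [degree_eq_linkCount, sum_sub_distrib, sum_filter, sum_filter, sum_filter,
    Fintype.sum_prod_type]
  ring_nf

variable {P : Params} {G G' : SimpleGraph V} {j w y z : V}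

theorem indirectTerm_self : indirectTerm P G j j = 0 := by
  simp [indirectTerm, essential_self]

theorem indirectTerm_of_adj (h : G.Adj j w) : indirectTerm P G j w = 0 := by
  simp [indirectTerm, essential_of_adj h, SimpleGraph.dist_eq_one_iff_adj.2 h]

theorem indirectTerm_of_mem (h : y ∈ essential G j w) :
    indirectTerm P G j w = (1 - P.γ) * P.b (G.dist j w) := by
  have h2 := two_le_dist_of_mem_essential h
  have h1 : (essential G j w).Nonempty := ⟨y, h⟩
  rw [indirectTerm, if_pos (by omega), if_pos h1]
  ring

theorem bridgeTerm_of_notMem (h : j ∉ essential G y z) : bridgeTerm P G j y z = 0 := by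
  simp [bridgeTerm, h]

theorem bridgeTerm_of_mem (h : j ∈ essential G y z) : bridgeTerm P G j y z =
    P.γ / ((essential G y z).card : ℝ) * (2 * P.b (G.dist y z)) := by
  simp [bridgeTerm, h]

theorem bridgeTerm_comm : bridgeTerm P G j y z = bridgeTerm P G j z y := by
  rw [bridgeTerm, bridgeTerm, essential_comm, SimpleGraph.dist_comm]

theorem bridgeTerm_nonneg (hγ : 0 ≤ P.γ) (hb : ∀ i, 1 ≤ i → 0 ≤ P.b i) :
    0 ≤ bridgeTerm P G j y z := by
  rw [bridgeTerm]
  split_ifs with h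
  · have := two_le_dist_of_mem_essential h
    have := hb (G.dist y z) (by omega)
    positivity
  · exact le_rfl

theorem indirectTerm_nonneg (hγ : P.γ ≤ 1) (hb : ∀ i, 1 ≤ i → 0 ≤ P.b i) :
    0 ≤ indirectTerm P G j w := by
  by_cases h : (essential G j w).Nonempty
  · obtain ⟨x, hx⟩ := h
    rw [indirectTerm_of_mem hx]
    have := two_le_dist_of_mem_essential hx
    exact mul_nonneg (by linarith) (hb _ (by omega))
  · rw [indirectTerm, if_neg h, sub_zero]
    split_ifs with h1
    · exact hb _ (by omega)
    · exact le_rfl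

end Terms

section Injective

variable {V W : Type*} [Fintype V] [Fintype W] {G : SimpleGraph V} {G' : SimpleGraph W}
  {y z : V}

theorem essential_map_of_acyclic (hG' : G'.IsAcyclic) (f : G →g G') (hf : Function.Injective f)
    (hr : G.Reachable y z) : essential G' (f y) (f z) = (essential G y z).map ⟨f, hf⟩ := by
  classical
  have key : ∀ (p : G.Walk y z) (q : G'.Walk (f y) (f z)), p.IsPath → q.IsPath →
      q.support = p.support.map f := by
    intro p q hp hq
    have := congrArg Subtype.val
      ((hG'.subsingleton_path _ _).elim ⟨p.map f, hp.map hf⟩ ⟨q, hq⟩)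
    simp only at this
    rw [← this, SimpleGraph.Walk.support_map]
  obtain ⟨p, hp, -⟩ := hr.exists_path_of_dist
  ext x
  simp only [mem_map, mem_essential, Function.Embedding.coeFn_mk]
  constructor
  · rintro ⟨h1, h2, -, h4⟩
    have hx := h4 (p.map f) (hp.map hf)
    rw [SimpleGraph.Walk.support_map, List.mem_map] at hx
    obtain ⟨a, ha, rfl⟩ := hx
    refine ⟨a, ⟨fun h => h1 (h ▸ rfl), fun h => h2 (h ▸ rfl), hr, fun q hq => ?_⟩, rfl⟩
    have h5 := h4 (p.map f) (hp.map hf)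
    rw [key q _ hq (hp.map hf), List.mem_map] at h5
    obtain ⟨a', ha', h⟩ := h5
    rwa [← hf h]
  · rintro ⟨a, ⟨h1, h2, -, h4⟩, rfl⟩
    refine ⟨hf.ne h1, hf.ne h2, hr.map f, fun q hq => ?_⟩
    rw [key p q hp hq]
    exact List.mem_map_of_mem (h4 p hp)

/-- Enlarging a network to a forest does not decrease utilities when links are worth their cost. -/
theorem utility_le_of_acyclic {P : Params} (hb : ∀ i, 1 ≤ i → 0 ≤ P.b i) (hγ₀ : 0 ≤ P.γ)
    (hγ₁ : P.γ ≤ 1) (hc : P.c ≤ P.b 1) (hG' : G'.IsAcyclic) (f : G →g G')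
    (hf : Function.Injective f) (j : V) : utility P G j ≤ utility P G' (f j) := by
  classical
  rw [utility_eq, utility_eq]
  have hdeg : linkCount G j ≤ linkCount G' (f j) := by
    rw [linkCount, linkCount, ← card_map ⟨f, hf⟩]
    refine card_le_card fun x hx => ?_
    simp only [mem_map, mem_filter, mem_univ, true_and, Function.Embedding.coeFn_mk] at hx ⊢
    obtain ⟨a, ha, rfl⟩ := hx
    exact f.map_adj ha
  have hind : ∀ w, indirectTerm P G j w ≤ indirectTerm P G' (f j) (f w) := by
    intro w
    by_cases hr : G.Reachable j w
    · rw [indirectTerm, indirectTerm, dist_map_of_acyclic hG' f hf hr,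
        essential_map_of_acyclic hG' f hf hr]
      simp only [map_nonempty]
      exact le_rfl
    · have h0 : indirectTerm P G j w = 0 := by
        have : essential G j w = ∅ := by
          ext x
          simp [mem_essential, hr]
        simp [indirectTerm, this, SimpleGraph.dist_eq_zero_of_not_reachable hr]
      rw [h0]
      exact indirectTerm_nonneg hγ₁ hb
  have hbr : ∀ y z, bridgeTerm P G j y z ≤ bridgeTerm P G' (f j) (f y) (f z) := by
    intro y z
    by_cases hr : G.Reachable y z
    · rw [bridgeTerm, bridgeTerm, dist_map_of_acyclic hG' f hf hr,
        essential_map_of_acyclic hG' f hf hr, card_map]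
      simp
    · rw [bridgeTerm_of_notMem (fun h => hr (mem_essential.1 h).2.2.1)]
      exact bridgeTerm_nonneg hγ₀ hb
  have sum_le : ∀ (s : V → ℝ) (t : W → ℝ), (∀ v, s v ≤ t (f v)) → (∀ w, 0 ≤ t w) →
      ∑ v, s v ≤ ∑ w, t w := by
    intro s t hst ht
    calc ∑ v, s v ≤ ∑ v, t (f v) := sum_le_sum fun v _ => hst v
      _ = ∑ w ∈ univ.map ⟨f, hf⟩, t w := by simp
      _ ≤ ∑ w, t w := sum_le_sum_of_subset_of_nonneg (subset_univ _) fun w _ _ => ht w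
  have h1 := sum_le _ _ hind fun w => indirectTerm_nonneg hγ₁ hb
  have h2 : ∑ y, ∑ z, bridgeTerm P G j y z ≤ ∑ y, ∑ z, bridgeTerm P G' (f j) y z :=
    sum_le _ _ (fun y => sum_le _ _ (hbr y) fun w => bridgeTerm_nonneg hγ₀ hb)
      fun y => sum_nonneg fun z _ => bridgeTerm_nonneg hγ₀ hb
  have h3 : (linkCount G j : ℝ) * (P.b 1 - P.c) ≤ linkCount G' (f j) * (P.b 1 - P.c) :=
    mul_le_mul_of_nonneg_right (by exact_mod_cast hdeg) (by linarith)
  linarith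

end Injective

/-- `G` consists of two linked centers `A` and `B` and of leaves; `h` maps a leaf to the center it
is linked to, and a center to itself. -/
structure IsHub {V : Type*} (G : SimpleGraph V) (h : V → V) (A B : V) : Prop where
  ne : A ≠ B
  left : h A = A
  right : h B = B
  hub : ∀ v, h v = A ∨ h v = B
  adj : ∀ x y, G.Adj x y ↔
    x ≠ y ∧ (h x = y ∨ h y = x ∨ (x = A ∧ y = B) ∨ (x = B ∧ y = A))

open Classical in
/-- The number of nodes attached to the center `A`, the center included. -/
noncomputable def fiberCard {V : Type*} [Fintype V] (h : V → V) (A : V) : ℕ := #{v | h v = A}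

theorem card_filter_eq_fiberCard {V : Type*} [Fintype V] (h : V → V) (A : V)
    [DecidablePred fun v => h v = A] :
    #{v | h v = A} = fiberCard h A := by
  unfold fiberCard
  congr

namespace IsHub

section Structure

variable {V : Type*} {G : SimpleGraph V} {h : V → V} {A B : V}

theorem symm (H : IsHub G h A B) : IsHub G h B A where
  ne := H.ne.symm
  left := H.right
  right := H.left
  hub v := (H.hub v).symm
  adj x y := by rw [H.adj]; tauto

theorem hub_hub (H : IsHub G h A B) (v : V) : h (h v) = h v := by
  rcases H.hub v with e | e <;> rw [e]
  exacts [H.left, H.right]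

theorem eq_of_fixed (H : IsHub G h A B) {v : V} (hv : h v = v) : v = A ∨ v = B := by
  rcases H.hub v with e | e
  · exact .inl (hv.symm.trans e)
  · exact .inr (hv.symm.trans e)

theorem adj_hub (H : IsHub G h A B) {v : V} (hv : h v ≠ v) : G.Adj v (h v) :=
  (H.adj _ _).2 ⟨hv.symm, .inl rfl⟩

theorem adj_centers (H : IsHub G h A B) : G.Adj A B :=
  (H.adj _ _).2 ⟨H.ne, .inr (.inr (.inl ⟨rfl, rfl⟩))⟩

theorem adj_hub_hub (H : IsHub G h A B) {v w : V} (hvw : h v ≠ h w) : G.Adj (h v) (h w) := by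
  have := H.adj_centers
  rcases H.hub v with e | e <;> rcases H.hub w with e' | e' <;> rw [e, e'] at hvw ⊢ <;>
    first | exact absurd rfl hvw | exact this | exact this.symm

theorem eq_hub_of_adj (H : IsHub G h A B) {u v : V} (hv : h v ≠ v) (huv : G.Adj u v) :
    u = h v := by
  obtain ⟨h1, h2 | h2 | h2 | h2⟩ := (H.adj _ _).1 huv
  · exact absurd (by rw [← h2, H.hub_hub]) hv
  · exact h2.symm
  · exact absurd (by rw [h2.2, H.right]) hv
  · exact absurd (by rw [h2.2, H.left]) hv

theorem connected (H : IsHub G h A B) : G.Connected := by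
  have key : ∀ v, G.Reachable v A := by
    intro v
    have h1 : G.Reachable v (h v) := by
      by_cases hv : h v = v
      · rw [hv]
      · exact (H.adj_hub hv).reachable
    rcases H.hub v with e | e
    · rwa [e] at h1
    · rw [e] at h1
      exact h1.trans H.adj_centers.symm.reachable
  have : Nonempty V := ⟨A⟩
  exact ⟨fun v w => (key v).trans (key w).symm⟩

theorem isAcyclic (H : IsHub G h A B) : G.IsAcyclic := by
  have leaf : ∀ v, h v ≠ v → ∀ w, G.Adj v w → ¬ (G.deleteEdges {s(v, w)}).Reachable v w := by
    intro v hv w hvw hr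
    have := reachable_mem_of_closed {v} ?_ rfl hr
    · exact hvw.ne this.symm
    · rintro u rfl x hux
      rw [SimpleGraph.deleteEdges_adj] at hux
      exact absurd (by rw [H.eq_hub_of_adj hv hux.1.symm, H.eq_hub_of_adj hv hvw.symm]; rfl) hux.2
  have center : ∀ {A B}, IsHub G h A B → ¬ (G.deleteEdges {s(A, B)}).Reachable A B := by
    intro A B H hr
    have := reachable_mem_of_closed {v | h v = A} ?_ H.left hr
    · exact H.ne (this.symm.trans H.right)
    · intro u hu x hux
      simp only [Set.mem_ofPred_eq] at hu ⊢
      rw [SimpleGraph.deleteEdges_adj, H.adj] at hux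
      obtain ⟨⟨h1, h2 | h2 | h2 | h2⟩, h3⟩ := hux
      · rw [← h2, H.hub_hub, hu]
      · rw [← hu, ← h2, H.hub_hub]
      · rw [h2.1, h2.2] at h3
        exact absurd rfl h3
      · exact absurd (hu.symm.trans (h2.1 ▸ H.right)) H.ne
  rw [SimpleGraph.isAcyclic_iff_forall_adj_isBridge]
  intro v w hvw
  rw [SimpleGraph.isBridge_iff]
  by_cases hv : h v = v
  · by_cases hw : h w = w
    · rcases H.eq_of_fixed hv with rfl | rfl <;> rcases H.eq_of_fixed hw with rfl | rfl
      · exact absurd rfl hvw.ne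
      · exact center H
      · exact center H.symm
      · exact absurd rfl hvw.ne
    · rw [SimpleGraph.reachable_comm, Sym2.eq_swap]
      exact leaf w hw v hvw.symm
  · exact leaf v hv w hvw

theorem dist_hub_le (H : IsHub G h A B) (v : V) : G.dist v (h v) ≤ 1 := by
  by_cases hv : h v = v
  · rw [hv]; simp
  · rw [SimpleGraph.dist_eq_one_iff_adj.2 (H.adj_hub hv)]

theorem dist_hub_hub_le (H : IsHub G h A B) (v w : V) : G.dist (h v) (h w) ≤ 1 := by
  by_cases hv : h v = h w
  · rw [hv]; simp
  · rw [SimpleGraph.dist_eq_one_iff_adj.2 (H.adj_hub_hub hv)]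

end Structure

section Distances

variable {V : Type*} [Fintype V] {G : SimpleGraph V} {h : V → V} {A B : V} {y z : V}

theorem hub_mem_essential (H : IsHub G h A B) (hyz : y ≠ z) (h1 : h y ≠ y) (h2 : h y ≠ z) :
    h y ∈ essential G y z :=
  mem_essential_of_pendant_left (fun _ hu => H.eq_hub_of_adj h1 hu) h1 h2 hyz (H.connected y z)

open Classical in
theorem essential_eq (H : IsHub G h A B) (hyz : y ≠ z) :
    essential G y z = {h y, h z} \ {y, z} := by
  ext x
  simp only [mem_sdiff, mem_insert, mem_singleton, not_or]
  constructor
  · intro hx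
    rw [mem_essential_iff_walk] at hx
    obtain ⟨h1, h2, -, h4⟩ := hx
    refine ⟨?_, h1, h2⟩
    have link : ∀ {a b : V}, (a ≠ b → G.Adj a b) →
        ∃ p : G.Walk a b, ∀ v ∈ p.support, v = a ∨ v = b := by
      intro a b hab
      by_cases e : a = b
      · subst e
        exact ⟨.nil, by simp⟩
      · exact ⟨(hab e).toWalk, by simp⟩
    obtain ⟨p, hp⟩ := link (fun e => H.adj_hub (v := y) e.symm)
    obtain ⟨q, hq⟩ := link (fun e => H.adj_hub_hub (v := y) (w := z) e)
    obtain ⟨r, hr⟩ := link (fun e => (H.adj_hub (v := z) e).symm)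
    have := h4 ((p.append q).append r)
    rw [SimpleGraph.Walk.mem_support_append_iff, SimpleGraph.Walk.mem_support_append_iff] at this
    rcases this with (hx | hx) | hx
    · have := hp x hx; tauto
    · have := hq x hx; tauto
    · have := hr x hx; tauto
  · rintro ⟨rfl | rfl, h1, h2⟩
    · exact H.hub_mem_essential hyz h1 h2
    · rw [essential_comm]
      exact H.hub_mem_essential hyz.symm h2 h1

theorem dist_eq_card (H : IsHub G h A B) (hyz : y ≠ z) :
    G.dist y z = (essential G y z).card + 1 := by
  classical
  refine le_antisymm ?_ (card_essential_lt_dist (H.connected y z) hyz)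
  rw [H.essential_eq hyz]
  have t1 : G.dist y z ≤ G.dist y (h y) + G.dist (h y) z := H.connected.dist_triangle
  have t2 : G.dist (h y) z ≤ G.dist (h y) (h z) + G.dist (h z) z := H.connected.dist_triangle
  have a1 := H.dist_hub_le y
  have a2 := H.dist_hub_hub_le y z
  have a3 := H.dist_hub_le z
  rw [SimpleGraph.dist_comm] at a3
  have z1 : h y = y → G.dist y (h y) = 0 := fun e => by rw [e]; simp
  have z2 : h y = h z → G.dist (h y) (h z) = 0 := fun e => by rw [e]; simp
  have z3 : h z = z → G.dist (h z) z = 0 := fun e => by rw [e]; simp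
  by_cases e1 : h y = y <;> by_cases e3 : h z = z
  · have := z1 e1
    have := z3 e3
    omega
  · by_cases e2 : h y = h z
    · have := z1 e1
      have := z2 e2
      omega
    · have : h z ∈ ({h y, h z} \ {y, z} : Finset V) := by
        simp only [mem_sdiff, mem_insert, mem_singleton, not_or]
        exact ⟨by simp, fun e => e2 (by rw [e1, e]), e3⟩
      have := card_pos.2 ⟨_, this⟩
      have := z1 e1
      omega
  · by_cases e2 : h y = h z
    · have := z3 e3
      have := z2 e2
      omega
    · have : h y ∈ ({h y, h z} \ {y, z} : Finset V) := by
        simp only [mem_sdiff, mem_insert, mem_singleton, not_or]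
        exact ⟨by simp, e1, fun e => e2 (by rw [e3, e])⟩
      have := card_pos.2 ⟨_, this⟩
      have := z3 e3
      omega
  · have hyz' : h y ≠ z := fun e => e3 (by rw [← e, H.hub_hub])
    have hzy' : h z ≠ y := fun e => e1 (by rw [← e, H.hub_hub])
    have hd : ({h y, h z} \ {y, z} : Finset V) = {h y, h z} := by
      ext x
      simp only [mem_sdiff, mem_insert, mem_singleton, not_or]
      refine ⟨fun h => h.1, ?_⟩
      rintro (rfl | rfl)
      · exact ⟨.inl rfl, e1, hyz'⟩
      · exact ⟨.inr rfl, hzy', e3⟩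
    rw [hd]
    by_cases e2 : h y = h z
    · have := z2 e2
      have : 0 < ({h y, h z} : Finset V).card := card_pos.2 ⟨h y, by simp⟩
      omega
    · rw [card_pair e2]
      omega

theorem dist_of_leaf (H : IsHub G h A B) (h1 : h y = y) (h2 : h z ≠ z) (h3 : h y ≠ h z) :
    G.dist y z = 2 := by
  classical
  have hyz : y ≠ z := by rintro rfl; exact h2 h1
  rw [H.dist_eq_card hyz, H.essential_eq hyz]
  have : ({h y, h z} \ {y, z} : Finset V) = {h z} := by
    ext x
    simp only [mem_sdiff, mem_insert, mem_singleton, not_or]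
    grind
  rw [this]; rfl

theorem dist_of_leaf_leaf (H : IsHub G h A B) (hyz : y ≠ z) (h1 : h y ≠ y) (h2 : h z ≠ z)
    (h3 : h y = h z) : G.dist y z = 2 := by
  classical
  rw [H.dist_eq_card hyz, H.essential_eq hyz]
  have : ({h y, h z} \ {y, z} : Finset V) = {h z} := by
    ext x
    simp only [mem_sdiff, mem_insert, mem_singleton, not_or]
    grind
  rw [this]; rfl

theorem dist_of_leaf_leaf_ne (H : IsHub G h A B) (h1 : h y ≠ y) (h2 : h z ≠ z)
    (h3 : h y ≠ h z) : G.dist y z = 3 := by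
  classical
  have hyz : y ≠ z := by rintro rfl; exact h3 rfl
  rw [H.dist_eq_card hyz, H.essential_eq hyz]
  have : ({h y, h z} \ {y, z} : Finset V) = {h y, h z} := by
    ext x
    simp only [mem_sdiff, mem_insert, mem_singleton, not_or]
    have := H.hub_hub y
    have := H.hub_hub z
    grind
  rw [this, card_pair h3]

end Distances

section Fibers

variable {V : Type*} [Fintype V] {G : SimpleGraph V} {h : V → V} {A B : V}

theorem fiberCard_pos (H : IsHub G h A B) : 0 < fiberCard h A := by
  classical
  exact card_pos.2 ⟨A, by simp [H.left]⟩

theorem fiberCard_add (H : IsHub G h A B) : fiberCard h A + fiberCard h B = Fintype.card V := by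
  classical
  rw [fiberCard, fiberCard, ← card_union_of_disjoint, ← card_univ]
  · congr 1
    ext v
    simpa using H.hub v
  · rw [disjoint_left]
    intro v hv hv'
    simp only [mem_filter, mem_univ, true_and] at hv hv'
    exact H.ne (hv.symm.trans hv')

theorem linkCount_center (H : IsHub G h A B) : linkCount G A = fiberCard h A := by
  classical
  rw [linkCount, fiberCard]
  have hA : A ∈ ({v | h v = A} : Finset V) := by simp [H.left]
  have hB : B ∉ ({v | h v = A} : Finset V).erase A := by simp [H.right, H.ne.symm]
  have h1 : ({w | G.Adj A w} : Finset V) = insert B (({v | h v = A} : Finset V).erase A) := by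
    ext w
    simp only [mem_filter, mem_univ, true_and, mem_insert, mem_erase, H.adj, H.left]
    have := H.ne
    grind
  rw [h1, card_insert_of_notMem hB, card_erase_add_one hA]

theorem linkCount_leaf (H : IsHub G h A B) {v : V} (hv : h v ≠ v) : linkCount G v = 1 := by
  classical
  rw [linkCount, card_eq_one]
  refine ⟨h v, ?_⟩
  ext w
  simp only [mem_filter, mem_univ, true_and, mem_singleton]
  exact ⟨fun e => H.eq_hub_of_adj hv e.symm, fun e => e ▸ H.adj_hub hv⟩

theorem isTwoStar (H : IsHub G h A B) (h1 : fiberCard h A ≤ fiberCard h B + 1)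
    (h2 : fiberCard h B ≤ fiberCard h A + 1) : IsTwoStar G := by
  classical
  have hc : ∀ {A B}, IsHub G h A B → #({v | h v = A ∧ v ≠ A} : Finset V) + 1 = fiberCard h A := by
    intro A B H
    rw [fiberCard, ← filter_filter, filter_ne', card_erase_add_one]
    simp [H.left]
  have e1 := hc H
  have e2 := hc H.symm
  refine ⟨A, B, univ.filter fun v => h v = A ∧ v ≠ A,
    univ.filter fun v => h v = B ∧ v ≠ B, H.ne, by simp, ?_, ?_, by simp, ?_,
    ?_, by omega, by omega, ?_⟩
  · simp [H.left, H.ne]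
  · simp [H.right, H.ne.symm]
  · rw [disjoint_left]
    intro v hv hv'
    simp only [mem_filter, mem_univ, true_and] at hv hv'
    exact H.ne (hv.1.symm.trans hv'.1)
  · intro v
    have := H.hub v
    simp only [mem_filter, mem_univ, true_and]
    tauto
  · ext x y
    rw [SimpleGraph.fromRel_adj, H.adj]
    simp only [mem_filter, mem_univ, true_and]
    have h1 := H.hub x
    have h2 := H.hub y
    have := H.left
    have := H.right
    have := H.ne
    refine and_congr_right fun _ => ?_
    grind

end Fibers

end IsHub

theorem le_add_dist_of_lipschitz {V : Type*} {G : SimpleGraph V} (φ : V → ℕ)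
    (hφ : ∀ u v, G.Adj u v → φ v ≤ φ u + 1) {y z : V} (hr : G.Reachable y z) :
    φ z ≤ φ y + G.dist y z := by
  obtain ⟨p, hp⟩ := hr.exists_walk_length_eq_dist
  rw [← hp]
  clear hp hr
  induction p with
  | nil => simp
  | cons h p ih =>
    have := hφ _ _ h
    rw [SimpleGraph.Walk.length_cons]
    omega

section Enter

variable {n : ℕ} {G : SimpleGraph (Fin n)} {t : Fin n}

theorem enter_adj_castSucc {v w : Fin n} :
    (enter G t).Adj v.castSucc w.castSucc ↔ G.Adj v w := by
  have := (Fin.castSucc_lt_last v).ne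
  have := (Fin.castSucc_lt_last w).ne
  simp only [enter, addLink, SimpleGraph.sup_adj, SimpleGraph.edge_adj]
  have key : (G.map Fin.castSuccEmb).Adj v.castSucc w.castSucc ↔ G.Adj v w :=
    SimpleGraph.map_adj_apply (f := Fin.castSuccEmb)
  rw [key]
  tauto

theorem enter_adj_last {u : Fin (n + 1)} :
    (enter G t).Adj u (Fin.last n) ↔ u = t.castSucc := by
  have := (Fin.castSucc_lt_last t).ne
  simp only [enter, addLink, SimpleGraph.sup_adj, SimpleGraph.edge_adj, SimpleGraph.map_adj]
  constructor
  · rintro (⟨a, b, -, -, hb⟩ | ⟨⟨rfl, h⟩ | ⟨h, -⟩, h'⟩)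
    · exact absurd hb (Fin.castSucc_lt_last b).ne
    · exact absurd rfl h'
    · exact h
  · rintro rfl
    exact .inr ⟨.inr ⟨by simp, by simp⟩, this⟩

/-- The inclusion of the old network in the new one. -/
def enterHom (G : SimpleGraph (Fin n)) (t : Fin n) : G →g enter G t where
  toFun := Fin.castSucc
  map_rel' h := enter_adj_castSucc.2 h

theorem exists_walk_enter {v w : Fin n} (p : G.Walk v w) :
    ∃ q : (enter G t).Walk v.castSucc w.castSucc,
      q.length = p.length ∧ Fin.last n ∉ q.support := by
  induction p with
  | nil => exact ⟨.nil, rfl, by simp [(Fin.castSucc_lt_last _).ne']⟩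
  | cons h p ih =>
    obtain ⟨q, h1, h2⟩ := ih
    exact ⟨.cons (enter_adj_castSucc.2 h) q, by simp [h1],
      by simp [h2, (Fin.castSucc_lt_last _).ne']⟩

theorem enter_connected (hG : G.Connected) : (enter G t).Connected := by
  have key : ∀ v, (enter G t).Reachable v t.castSucc := by
    intro v
    induction v using Fin.lastCases with
    | last => exact (enter_adj_last.2 rfl).symm.reachable
    | cast v => exact (hG v t).map (enterHom G t)
  exact ⟨fun v w => (key v).trans (key w).symm⟩

theorem dist_enter_last (hG : G.Connected) (w : Fin n) :
    (enter G t).dist (Fin.last n) w.castSucc = G.dist t w + 1 := by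
  apply le_antisymm
  · obtain ⟨p, hp⟩ := hG.exists_walk_length_eq_dist t w
    obtain ⟨q, hq, -⟩ := exists_walk_enter (t := t) p
    rw [← hp, ← hq]
    exact SimpleGraph.dist_le (SimpleGraph.Walk.cons (enter_adj_last.2 rfl).symm q)
  · have := le_add_dist_of_lipschitz (G := enter G t)
      (Fin.lastCases 0 fun v => G.dist t v + 1) ?_
      ((enter_connected hG) (Fin.last n) w.castSucc)
    · simpa using this
    · intro u v huv
      induction u using Fin.lastCases with
      | last =>
        rw [SimpleGraph.adj_comm, enter_adj_last] at huv
        simp [huv]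
      | cast u =>
        induction v using Fin.lastCases with
        | last => simp
        | cast v =>
          rw [enter_adj_castSucc] at huv
          have h1 : G.dist t v ≤ G.dist t u + G.dist u v := hG.dist_triangle
          rw [SimpleGraph.dist_eq_one_iff_adj.2 huv] at h1
          simpa using h1

theorem last_notMem_essential_enter (hG : G.Connected) (y z : Fin (n + 1)) :
    Fin.last n ∉ essential (enter G t) y z := by
  intro h
  rw [mem_essential_iff_walk] at h
  obtain ⟨h1, h2, -, h4⟩ := h
  induction y using Fin.lastCases with
  | last => exact h1 rfl
  | cast y =>
    induction z using Fin.lastCases with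
    | last => exact h2 rfl
    | cast z =>
      obtain ⟨p⟩ := hG y z
      obtain ⟨q, -, hq⟩ := exists_walk_enter (t := t) p
      exact hq (h4 q)

/-- The utility of a node that enters a connected network. -/
theorem entryUtility_eq (P : Params) (hG : G.Connected) : entryUtility P G t =
    P.b 1 - P.c + (1 - P.γ) * (∑ w, if w = t then 0 else P.b (G.dist t w + 1))
      - P.c₀ * linkCount G t := by
  classical
  have h1 : linkCount (enter G t) (Fin.last n) = 1 := by
    rw [linkCount, card_eq_one]
    refine ⟨t.castSucc, ?_⟩
    ext w
    simp [SimpleGraph.adj_comm, enter_adj_last]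
  rw [entryUtility, degree_eq_linkCount, utility_eq, h1, Fin.sum_univ_castSucc,
    indirectTerm_self, sum_eq_zero (s := univ) (f := fun y => ∑ z, bridgeTerm P _ _ y z), mul_sum]
  · have : ∀ w : Fin n, indirectTerm P (enter G t) (Fin.last n) w.castSucc =
        (1 - P.γ) * if w = t then 0 else P.b (G.dist t w + 1) := by
      intro w
      split_ifs with hw
      · rw [hw, indirectTerm_of_adj (enter_adj_last.2 rfl).symm, mul_zero]
      · rw [← dist_enter_last hG]
        exact indirectTerm_of_mem (mem_essential_of_pendant_left
          (fun u hu => enter_adj_last.1 hu) (Fin.castSucc_lt_last t).ne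
          (fun e => hw (Fin.castSucc_injective n e).symm) (Fin.castSucc_lt_last w).ne'
          (enter_connected hG _ _))
    rw [sum_congr rfl fun w _ => this w]
    push_cast
    ring
  · intro y _
    exact sum_eq_zero fun z _ => bridgeTerm_of_notMem (last_notMem_essential_enter hG y z)

end Enter

namespace IsHub

section Fin

variable {n : ℕ} {G : SimpleGraph (Fin n)} {h : Fin n → Fin n} {A B : Fin n}

theorem enter (H : IsHub G h A B) :
    IsHub (enter G A) (Fin.lastCases A.castSucc fun v => (h v).castSucc)
      A.castSucc B.castSucc where
  ne := fun e => H.ne (Fin.castSucc_injective n e)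
  left := by simp [H.left]
  right := by simp [H.right]
  hub v := by
    induction v using Fin.lastCases with
    | last => simp
    | cast v => simpa using H.hub v
  adj x y := by
    have hl := fun v : Fin n => (Fin.castSucc_lt_last v).ne
    have hl' := fun v : Fin n => (Fin.castSucc_lt_last v).ne'
    induction x using Fin.lastCases with
    | last =>
      induction y using Fin.lastCases with
      | last => simp
      | cast y =>
        rw [SimpleGraph.adj_comm, enter_adj_last]
        simp [hl, hl', eq_comm]
    | cast x =>
      induction y using Fin.lastCases with
      | last =>
        rw [enter_adj_last]
        simp [hl, hl', eq_comm]
      | cast y =>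
        rw [enter_adj_castSucc, H.adj]
        simp

theorem fiberCard_enter (A C : Fin n) :
    fiberCard (Fin.lastCases A.castSucc fun v => (h v).castSucc : Fin (n + 1) → Fin (n + 1))
      C.castSucc = fiberCard h C + if A = C then 1 else 0 := by
  classical
  rw [← card_filter_eq_fiberCard, ← card_filter_eq_fiberCard, card_filter, card_filter,
    Fin.sum_univ_castSucc]
  simp only [Fin.lastCases_castSucc, Fin.lastCases_last, Fin.castSucc_inj]

end Fin

section Sum

variable {V : Type*} [Fintype V] {G : SimpleGraph V} {h : V → V} {A B : V}

/-- The benefits at a distance increased by one, as seen from a center. -/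
theorem sum_center (H : IsHub G h A B) (b : ℕ → ℝ) [DecidableEq V] :
    ∑ w, (if w = A then 0 else b (G.dist A w + 1)) =
      fiberCard h A * b 2 + (fiberCard h B - 1) * b 3 := by
  have key : ∀ w, (if w = A then 0 else b (G.dist A w + 1)) =
      (if h w = A then b 2 else 0) + (if h w = B then b 3 else 0)
        + (if w = A then - b 2 else 0) + (if w = B then b 2 - b 3 else 0) := by
    intro w
    have hne := H.ne
    have hA := H.left
    have hB := H.right
    by_cases h1 : w = A
    · simp [h1, hne, hA]
    by_cases h2 : w = B
    · simp [h2, hne.symm, hB, SimpleGraph.dist_eq_one_iff_adj.2 H.adj_centers]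
    have h3 : h w ≠ w := fun e => (H.eq_of_fixed e).elim h1 h2
    rcases H.hub w with e | e
    · have := H.adj_hub h3
      rw [e] at this
      simp [h1, h2, e, hne, SimpleGraph.dist_eq_one_iff_adj.2 this.symm]
    · have := H.dist_of_leaf hA h3 (by rw [hA, e]; exact hne)
      simp [h1, h2, e, hne.symm, this]
  rw [sum_congr rfl fun w _ => key w]
  simp only [sum_add_distrib, sum_ite_eq', mem_univ, if_true]
  rw [← sum_filter, ← sum_filter, sum_const, sum_const, nsmul_eq_mul, nsmul_eq_mul]
  rw [card_filter_eq_fiberCard, card_filter_eq_fiberCard]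
  ring

/-- The benefits at a distance increased by one, as seen from a leaf. -/
theorem sum_leaf (H : IsHub G h A B) (b : ℕ → ℝ) {t : V} (ht : h t = B) (ht' : t ≠ B)
    [DecidableEq V] :
    ∑ w, (if w = t then 0 else b (G.dist t w + 1)) =
      b 2 + (fiberCard h B - 1) * b 3 + (fiberCard h A - 1) * b 4 := by
  have key : ∀ w, (if w = t then 0 else b (G.dist t w + 1)) =
      (if h w = A then b 4 else 0) + (if h w = B then b 3 else 0)
        + (if w = A then b 3 - b 4 else 0) + (if w = B then b 2 - b 3 else 0)
        + (if w = t then - b 3 else 0) := by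
    intro w
    have hne := H.ne
    have hA := H.left
    have hB := H.right
    have hlt : h t ≠ t := ht ▸ ht'.symm
    have htA : t ≠ A := fun e => hne (by rw [← ht, e, hA])
    by_cases h1 : w = t
    · simp [h1, htA, ht, ht', hne.symm]
    by_cases h2 : w = B
    · have := SimpleGraph.dist_eq_one_iff_adj.2 (H.adj_hub hlt)
      rw [ht] at this
      simp [h2, ht'.symm, hne.symm, hB, this]
    by_cases h4 : w = A
    · have := H.dist_of_leaf hA hlt (by rw [hA, ht]; exact hne)
      rw [SimpleGraph.dist_comm] at this
      simp [h4, htA.symm, hne, hA, this]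
    have h3 : h w ≠ w := fun e => (H.eq_of_fixed e).elim h4 h2
    rcases H.hub w with e | e
    · have := H.dist_of_leaf_leaf_ne hlt h3 (by rw [ht, e]; exact hne.symm)
      simp [h1, h2, h4, e, hne, this]
    · have := H.dist_of_leaf_leaf (Ne.symm h1) hlt h3 (by rw [ht, e])
      simp [h1, h2, h4, e, hne.symm, this]
  rw [sum_congr rfl fun w _ => key w]
  simp only [sum_add_distrib, sum_ite_eq', mem_univ, if_true]
  rw [← sum_filter, ← sum_filter, sum_const, sum_const, nsmul_eq_mul, nsmul_eq_mul]
  rw [card_filter_eq_fiberCard, card_filter_eq_fiberCard]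
  ring

end Sum

end IsHub

section AddLink

variable {V : Type*} {G : SimpleGraph V} {i j : V}

theorem addLink_adj (hij : i ≠ j) {u v : V} :
    (addLink G i j).Adj u v ↔ G.Adj u v ∨ (u = i ∧ v = j) ∨ (u = j ∧ v = i) := by
  simp only [addLink, SimpleGraph.sup_adj, SimpleGraph.edge_adj]
  constructor
  · tauto
  · rintro (h | ⟨rfl, rfl⟩ | ⟨rfl, rfl⟩)
    · exact .inl h
    · exact .inr ⟨.inl ⟨rfl, rfl⟩, hij⟩
    · exact .inr ⟨.inr ⟨rfl, rfl⟩, hij.symm⟩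

theorem addLink_comm (G : SimpleGraph V) (i j : V) : addLink G i j = addLink G j i := by
  rw [addLink, addLink, SimpleGraph.edge_comm]

theorem le_addLink (G : SimpleGraph V) (i j : V) : G ≤ addLink G i j := le_sup_left

theorem linkCount_addLink [Fintype V] (hij : i ≠ j) (h : ¬ G.Adj i j) :
    linkCount (addLink G i j) i = linkCount G i + 1 := by
  classical
  have h1 : ({w | (addLink G i j).Adj i w} : Finset V) = insert j ({w | G.Adj i w} : Finset V) := by
    ext w
    simp only [mem_filter, mem_univ, true_and, mem_insert, addLink_adj hij]
    grind
  rw [linkCount, linkCount, h1, card_insert_of_notMem (by simpa using h)]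

end AddLink

section Bounds

variable {V : Type*} [Fintype V] {P : Params} {G : SimpleGraph V} {j w y z : V}

theorem benefit_le {b : ℕ → ℝ} (hb : ∀ i, 1 ≤ i → b (i + 1) < b i) {i k : ℕ} (hi : 1 ≤ i)
    (hik : i ≤ k) : b k ≤ b i := by
  induction k, hik using Nat.le_induction with
  | base => exact le_rfl
  | succ k hk ih => exact (hb k (hi.trans hk)).le.trans ih

theorem indirectTerm_le (hb : ∀ i, 1 ≤ i → 0 ≤ P.b i) (hγ : 0 ≤ P.γ) (hd : G.dist j w ≤ 2) :
    indirectTerm P G j w ≤ P.b 2 := by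
  have h2 := hb 2 (by norm_num)
  by_cases h : (essential G j w).Nonempty
  · obtain ⟨x, hx⟩ := h
    have := two_le_dist_of_mem_essential hx
    rw [indirectTerm_of_mem hx, le_antisymm hd this]
    nlinarith
  · rw [indirectTerm, if_neg h, sub_zero]
    split_ifs with h1
    · rw [le_antisymm hd h1]
    · exact h2

theorem bridgeTerm_le (hb : ∀ i, 1 ≤ i → 0 ≤ P.b i) (hb' : ∀ i, 1 ≤ i → P.b (i + 1) < P.b i)
    (hγ : 0 ≤ P.γ) : bridgeTerm P G j y z ≤ P.γ * (2 * P.b 2) := by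
  have h2 := hb 2 (by norm_num)
  by_cases h : j ∈ essential G y z
  · rw [bridgeTerm_of_mem h]
    have h3 := two_le_dist_of_mem_essential h
    have h4 : 1 ≤ (essential G y z).card := card_pos.2 ⟨j, h⟩
    have h5 : (1 : ℝ) ≤ (essential G y z).card := by exact_mod_cast h4
    have h6 := benefit_le hb' (by norm_num) h3
    exact mul_le_mul (div_le_self hγ h5) (by linarith)
      (by have := hb (G.dist y z) (by omega); linarith) hγ
  · rw [bridgeTerm_of_notMem h]
    positivity

end Bounds

namespace IsHub

theorem pendant_addLink {V : Type*} {G : SimpleGraph V} {h : V → V} {A B : V}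
    (H : IsHub G h A B) {i j w : V} (hij : i ≠ j) (hw : h w ≠ w)
    (hi : w ≠ i) (hj : w ≠ j) {u : V} (hu : (addLink G i j).Adj u w) : u = h w := by
  rw [addLink_adj hij] at hu
  rcases hu with hu | ⟨-, rfl⟩ | ⟨-, rfl⟩
  · exact H.eq_hub_of_adj hw hu
  · exact absurd rfl hj
  · exact absurd rfl hi

variable {V : Type*} [Fintype V] {P : Params} {G G' : SimpleGraph V} {h : V → V} {A B : V}
  {j x y z : V}

theorem notMem_essential_of_leaf (H : IsHub G h A B) (hx : h x ≠ x) : x ∉ essential G y z := by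
  classical
  intro hm
  have hyz : y ≠ z := by
    rintro rfl
    simp [essential_self] at hm
  rw [H.essential_eq hyz] at hm
  simp only [mem_sdiff, mem_insert, mem_singleton] at hm
  obtain ⟨rfl | rfl, -⟩ := hm <;> exact hx (H.hub_hub _)

/-- If no essential node is bypassed when links are added, then no distance shrinks either. -/
theorem essential_dist_eq (H : IsHub G h A B) (hle : G ≤ G')
    (hs : essential G y z ⊆ essential G' y z) :
    essential G' y z = essential G y z ∧ G'.dist y z = G.dist y z := by
  have hr := H.connected y z
  have he := (essential_anti hle hr).antisymm hs
  refine ⟨he, ?_⟩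
  by_cases hyz : y = z
  · simp [hyz]
  · apply le_antisymm (hr.dist_anti hle)
    rw [H.dist_eq_card hyz, ← he]
    exact card_essential_lt_dist (hr.mono hle) hyz

theorem indirectTerm_eq_of_subset (H : IsHub G h A B) (hle : G ≤ G')
    (hs : essential G y z ⊆ essential G' y z) :
    indirectTerm P G' y z = indirectTerm P G y z := by
  obtain ⟨h1, h2⟩ := H.essential_dist_eq hle hs
  rw [indirectTerm, indirectTerm, h1, h2]

theorem bridgeTerm_eq_of_subset (H : IsHub G h A B) (hle : G ≤ G')
    (hs : essential G y z ⊆ essential G' y z) :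
    bridgeTerm P G' j y z = bridgeTerm P G j y z := by
  obtain ⟨h1, h2⟩ := H.essential_dist_eq hle hs
  rw [bridgeTerm, bridgeTerm, h1, h2]

/-- It suffices to keep those hubs essential that are not next to a node with an unaltered link. -/
theorem essential_subset (H : IsHub G h A B) (hle : G ≤ G')
    (hy : h y ≠ y → h y ≠ z → (∀ u, G'.Adj u y → u = h y) ∨ h y ∈ essential G' y z)
    (hz : h z ≠ z → h z ≠ y → (∀ u, G'.Adj u z → u = h z) ∨ h z ∈ essential G' y z) :
    essential G y z ⊆ essential G' y z := by
  classical
  by_cases hyz : y = z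
  · simp [hyz, essential_self]
  intro m hm
  rw [H.essential_eq hyz] at hm
  simp only [mem_sdiff, mem_insert, mem_singleton, not_or] at hm
  have hr := (H.connected y z).mono hle
  obtain ⟨rfl | rfl, h1, h2⟩ := hm
  · exact (hy h1 h2).elim (fun hp => mem_essential_of_pendant_left hp h1 h2 hyz hr) id
  · exact (hz h2 h1).elim (fun hp => mem_essential_of_pendant hp h1 h2 hyz hr) id

theorem utility_leaf (H : IsHub G h A B) (hle : G ≤ G') (hx : h x ≠ x) :
    utility P G' x = linkCount G' x * (P.b 1 - P.c) + ∑ w, indirectTerm P G' x w := by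
  rw [utility_eq, sum_eq_zero (f := fun y => ∑ z, bridgeTerm P G' x y z), mul_zero, add_zero]
  intro y _
  exact sum_eq_zero fun z _ => bridgeTerm_of_notMem fun hm =>
    H.notMem_essential_of_leaf hx (essential_anti hle (H.connected y z) hm)

/-- A link between two leaves of the same center is not worth its cost. -/
theorem utility_addLink_same (H : IsHub G h A B) (hc : P.b 1 - P.c ≤ (1 - P.γ) * P.b 2)
    (hxy : x ≠ y) (hx : h x ≠ x) (hy : h y ≠ y) (he : h x = h y) :
    utility P (addLink G x y) x ≤ utility P G x := by
  classical
  have hnadj : ¬ G.Adj x y := fun e => hy (by rw [← H.eq_hub_of_adj hy e] at he; exact absurd he hx)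
  have hle := le_addLink G x y
  rw [H.utility_leaf hle hx, H.utility_leaf le_rfl hx, linkCount_addLink hxy hnadj]
  have key : ∀ w, indirectTerm P (addLink G x y) x w ≤
      indirectTerm P G x w + if w = y then - ((1 - P.γ) * P.b 2) else 0 := by
    intro w
    split_ifs with hw
    · subst hw
      have h1 : indirectTerm P G x w = (1 - P.γ) * P.b 2 := by
        rw [← H.dist_of_leaf_leaf hxy hx hy he]
        exact indirectTerm_of_mem (H.hub_mem_essential hxy hx (he ▸ hy))
      rw [h1, indirectTerm_of_adj ((addLink_adj hxy).2 (.inr (.inl ⟨rfl, rfl⟩)))]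
      linarith
    · rw [add_zero]
      by_cases hxw : w = x
      · rw [hxw, indirectTerm_self, indirectTerm_self]
      refine (H.indirectTerm_eq_of_subset hle (H.essential_subset hle ?_ ?_)).le
      · intro h1 h2
        right
        refine mem_essential_of_cut {x, y} (by simp) (by simp [hw, hxw]) ?_ h2
          ((H.connected x w).mono hle) ?_
        · simp only [Set.mem_insert_iff, Set.mem_singleton_iff, not_or]
          exact ⟨hx, he ▸ hy⟩
        · intro u hu v hv huv
          simp only [Set.mem_insert_iff, Set.mem_singleton_iff, not_or] at hu hv
          rw [addLink_adj hxy] at huv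
          rcases huv with huv | ⟨-, rfl⟩ | ⟨-, rfl⟩
          · rcases hu with rfl | rfl
            · exact H.eq_hub_of_adj hx huv.symm
            · exact he ▸ H.eq_hub_of_adj hy huv.symm
          · exact absurd rfl hv.2
          · exact absurd rfl hv.1
      · intro h1 h2
        exact .inl fun u hu => H.pendant_addLink hxy h1 hxw hw hu
  have hs := sum_le_sum fun w (_ : w ∈ univ) => key w
  rw [sum_add_distrib, sum_ite_eq' univ y, if_pos (mem_univ y)] at hs
  push_cast
  linarith

/-- A link between leaves of different centers is not worth its cost. -/
theorem utility_addLink_leaves (H : IsHub G h A B) (hb : ∀ i, 1 ≤ i → 0 ≤ P.b i)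
    (hγ : 0 ≤ P.γ) (hc : P.b 1 - P.c ≤ P.b 3 - P.γ * (P.b 2 + P.b 3))
    (hx : h x ≠ x) (hy : h y ≠ y) (he : h x ≠ h y) :
    utility P (addLink G x y) x ≤ utility P G x := by
  classical
  have hxy : x ≠ y := by rintro rfl; exact he rfl
  have hxx := H.hub_hub x
  have hyy := H.hub_hub y
  have hxy' : h x ≠ y := fun e => hy (by rw [← e, H.hub_hub])
  have hyx' : h y ≠ x := fun e => hx (by rw [← e, H.hub_hub])
  have hnadj : ¬ G.Adj x y := fun e => hyx' (H.eq_hub_of_adj hy e).symm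
  have hle := le_addLink G x y
  rw [H.utility_leaf hle hx, H.utility_leaf le_rfl hx, linkCount_addLink hxy hnadj]
  have hub : ∀ v, h v = h x ∨ h v = h y := by
    intro v
    have h1 := H.hub v
    have h2 := H.hub x
    have h3 := H.hub y
    grind
  have key : ∀ w, indirectTerm P (addLink G x y) x w ≤
      indirectTerm P G x w + (if w = y then - ((1 - P.γ) * P.b 3) else 0)
        + if w = h y then P.γ * P.b 2 else 0 := by
    intro w
    by_cases hw : w = y
    · rw [if_pos hw, if_neg (fun e => hy (by rw [← e, hw])), hw]
      have h1 : indirectTerm P G x y = (1 - P.γ) * P.b 3 := by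
        rw [← H.dist_of_leaf_leaf_ne hx hy he]
        exact indirectTerm_of_mem (H.hub_mem_essential hxy hx hxy')
      rw [h1, indirectTerm_of_adj ((addLink_adj hxy).2 (.inr (.inl ⟨rfl, rfl⟩)))]
      linarith
    rw [if_neg hw, add_zero]
    by_cases hw' : w = h y
    · rw [if_pos hw', hw']
      have hd : G.dist x (h y) = 2 := by
        rw [SimpleGraph.dist_comm]
        exact H.dist_of_leaf hyy hx (by rw [hyy]; exact he.symm)
      have h1 : indirectTerm P G x (h y) = (1 - P.γ) * P.b 2 := by
        rw [← hd]
        exact indirectTerm_of_mem (H.hub_mem_essential hyx'.symm hx he)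
      have h2 : indirectTerm P (addLink G x y) x (h y) ≤ P.b 2 :=
        indirectTerm_le hb hγ (((H.connected x (h y)).dist_anti hle).trans hd.le)
      rw [h1]
      linarith
    rw [if_neg hw', add_zero]
    by_cases hxw : w = x
    · rw [hxw, indirectTerm_self, indirectTerm_self]
    have hpend : h w ≠ w → ∀ u, (addLink G x y).Adj u w → u = h w :=
      fun h1 u hu => H.pendant_addLink hxy h1 hxw hw hu
    by_cases hwx : h w = h x
    · refine (H.indirectTerm_eq_of_subset hle (H.essential_subset hle ?_ ?_)).le
      · intro h1 h2
        right
        rw [← hwx] at h1 h2 ⊢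
        exact mem_essential_of_pendant (hpend h2) h1 h2 (Ne.symm hxw)
          ((H.connected x w).mono hle)
      · exact fun h1 _ => .inl (hpend h1)
    · have hwy : h w = h y := (hub w).resolve_left hwx
      have hww : h w ≠ w := fun e => hw' (by rw [← hwy, e])
      have hr := (H.connected x w).mono hle
      have hd : G.dist x w = 3 := H.dist_of_leaf_leaf_ne hx hww (Ne.symm hwx)
      have hd' : (addLink G x y).dist x w = 3 := by
        apply le_antisymm
        · rw [← hd]
          exact (H.connected x w).dist_anti hle
        · have := le_add_dist_of_lipschitz (G := addLink G x y)
            (fun v => if v = x then 0 else if v = y ∨ v = h x then 1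
              else if v = h y ∨ h v = h x then 2 else 3) ?_ hr
          · simpa [hxw, hw, hw', hwx, show w ≠ h x from fun e => hwx (by rw [e, hxx])] using this
          · intro u v huv
            rw [addLink_adj hxy] at huv
            have h3 := hub u
            have h4 := hub v
            rcases huv with huv | ⟨rfl, rfl⟩ | ⟨rfl, rfl⟩
            · have h1 := fun e => H.eq_hub_of_adj (u := u) (v := v) e huv
              have h2 := fun e => H.eq_hub_of_adj (u := v) (v := u) e huv.symm
              grind
            · grind
            · grind
      rw [indirectTerm_of_mem (H.hub_mem_essential (Ne.symm hxw) hx fun e => hwx (by rw [← e, hxx])),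
        indirectTerm_of_mem (mem_essential_of_pendant (hpend hww)
          (fun e => hx (by rw [← e, H.hub_hub])) hww (Ne.symm hxw) hr), hd, hd']
  have hs := sum_le_sum fun w (_ : w ∈ univ) => key w
  rw [sum_add_distrib, sum_add_distrib, sum_ite_eq' univ y, sum_ite_eq' univ (h y),
    if_pos (mem_univ _), if_pos (mem_univ _)] at hs
  push_cast
  linarith

/-- A center loses from a link with a leaf of the other center. -/
theorem utility_addLink_center (H : IsHub G h A B) (hb : ∀ i, 1 ≤ i → 0 ≤ P.b i)
    (hb' : ∀ i, 1 ≤ i → P.b (i + 1) < P.b i) (hγ : 0 ≤ P.γ)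
    (hc : P.b 1 - P.c - (1 - P.γ) * P.b 2
      + ((fiberCard h B : ℝ) - 1) * (P.γ * (2 * P.b 2 - P.b 3)) < 0)
    (hx : h x = A) (hxA : x ≠ A) :
    utility P (addLink G B x) B < utility P G B := by
  classical
  have hne := H.ne
  have hA := H.left
  have hB := H.right
  have hxB : B ≠ x := by
    rintro rfl
    exact hne (hx.symm.trans hB)
  have hxx : h x ≠ x := hx ▸ hxA.symm
  have hnadj : ¬ G.Adj B x := fun e => hne (hx ▸ (H.eq_hub_of_adj hxx e).symm)
  have hle := le_addLink G B x
  have hpend : ∀ {w}, w ≠ x → h w ≠ w → ∀ u, (addLink G B x).Adj u w → u = h w :=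
    fun hwx h1 u hu => H.pendant_addLink hxB h1 (fun e => h1 (by rw [e, hB])) hwx hu
  rw [utility_eq, utility_eq, linkCount_addLink hxB hnadj]
  have key : ∀ w, indirectTerm P (addLink G B x) B w ≤
      indirectTerm P G B w + if w = x then - ((1 - P.γ) * P.b 2) else 0 := by
    intro w
    split_ifs with hw
    · subst hw
      have h1 : indirectTerm P G B w = (1 - P.γ) * P.b 2 := by
        rw [← H.dist_of_leaf hB hxx (by rw [hB, hx]; exact hne.symm)]
        refine indirectTerm_of_mem (y := A) ?_
        rw [essential_comm, ← hx]
        exact H.hub_mem_essential hxB.symm hxx (hx ▸ hne)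
      rw [h1, indirectTerm_of_adj ((addLink_adj hxB).2 (.inr (.inl ⟨rfl, rfl⟩)))]
      linarith
    · rw [add_zero]
      refine (H.indirectTerm_eq_of_subset hle (H.essential_subset hle ?_ ?_)).le
      · exact fun h1 => absurd hB h1
      · exact fun h1 _ => .inl (hpend hw h1)
  have hs := sum_le_sum fun w (_ : w ∈ univ) => key w
  rw [sum_add_distrib, sum_ite_eq' univ x, if_pos (mem_univ x)] at hs
  set κ := P.γ * (2 * P.b 2 - P.b 3) with hκ
  have hκ₀ : 0 ≤ κ := by
    have := hb 2 (by norm_num)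
    have := hb' 2 (by norm_num)
    exact mul_nonneg hγ (by norm_num at this; linarith)
  set g : V → ℝ := fun z => (if h z = B then κ else 0) + if z = B then - κ else 0 with hg
  have hg₀ : ∀ z, 0 ≤ g z := by
    intro z
    simp only [hg]
    split_ifs with h1 h2 h2
    · linarith
    · linarith
    · exact absurd (h2 ▸ hB) h1
    · linarith
  have hgs : ∑ z, g z = ((fiberCard h B : ℝ) - 1) * κ := by
    simp only [hg]
    rw [sum_add_distrib, sum_ite_eq' univ B, if_pos (mem_univ B), ← sum_filter, sum_const,
      card_filter_eq_fiberCard, nsmul_eq_mul]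
    ring
  have hpair : ∀ z, bridgeTerm P (addLink G B x) B x z ≤ bridgeTerm P G B x z + g z := by
    intro z
    by_cases hm : B ∈ essential (addLink G B x) x z
    · have hm' := essential_anti hle (H.connected x z) hm
      have hxz : x ≠ z := by
        rintro rfl
        simp [essential_self] at hm
      have hzB : z ≠ B := (mem_essential.1 hm).2.1.symm
      have he := H.essential_eq hxz
      have hz : h z = B := by
        rw [he] at hm'
        simp only [mem_sdiff, mem_insert, mem_singleton, hx] at hm'
        exact (hm'.1.resolve_left hne.symm).symm
      have hzz : h z ≠ z := hz ▸ hzB.symm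
      have hd := H.dist_of_leaf_leaf_ne hxx hzz (by rw [hx, hz]; exact hne)
      have hcard : (essential G x z).card = 2 := by
        have := H.dist_eq_card hxz
        omega
      have h1 := bridgeTerm_le (G := addLink G B x) (j := B) (y := x) (z := z) hb hb' hγ
      rw [bridgeTerm_of_mem hm', hd, hcard]
      simp only [hg, if_pos hz, if_neg hzB, hκ]
      push_cast
      linarith
    · rw [bridgeTerm_of_notMem hm]
      exact add_nonneg (bridgeTerm_nonneg hγ hb) (hg₀ z)
  have hbr : ∀ y z, bridgeTerm P (addLink G B x) B y z ≤
      bridgeTerm P G B y z + (if y = x then g z else 0) + if z = x then g y else 0 := by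
    intro y z
    by_cases hy : y = x
    · have h1 := hpair z
      have h2 := hg₀ y
      rw [if_pos hy, hy]
      rw [hy] at h2
      split_ifs <;> linarith
    · rw [if_neg hy, add_zero]
      by_cases hz : z = x
      · rw [if_pos hz, hz, bridgeTerm_comm, bridgeTerm_comm (G := G)]
        exact hpair y
      · rw [if_neg hz, add_zero]
        refine (H.bridgeTerm_eq_of_subset hle (H.essential_subset hle ?_ ?_)).le
        · exact fun h1 _ => .inl (hpend hy h1)
        · exact fun h1 _ => .inl (hpend hz h1)
  have hs' := sum_le_sum fun y (_ : y ∈ univ) => sum_le_sum fun z (_ : z ∈ univ) => hbr y z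
  have e1 : ∑ y, ∑ z, (if y = x then g z else 0) = ∑ z, g z := by
    rw [sum_comm]
    simp
  have e2 : ∑ y, ∑ z, (if z = x then g y else 0) = ∑ z, g z := by simp
  simp only [sum_add_distrib] at hs'
  rw [e1, e2, hgs] at hs'
  push_cast
  linarith

end IsHub

/-- `A` and `B` are the centers of a 2-star in which `A` has as many leaves as `B`, or one less. -/
def IsBalanced {V : Type*} [Fintype V] (G : SimpleGraph V) (A B : V) : Prop :=
  ∃ h, IsHub G h A B ∧ fiberCard h A ≤ fiberCard h B ∧ fiberCard h B ≤ fiberCard h A + 1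

theorem IsBalanced.isTwoStar {V : Type*} [Fintype V] {G : SimpleGraph V} {A B : V}
    (H : IsBalanced G A B) : IsTwoStar G := by
  obtain ⟨h, H, h1, h2⟩ := H
  exact H.isTwoStar (by omega) h2

/-- Benefits are nonnegative and decreasing, and links are worth their cost. -/
structure Params.Regular (P : Params) : Prop where
  nonneg : ∀ i, 1 ≤ i → 0 ≤ P.b i
  decay : ∀ i, 1 ≤ i → P.b (i + 1) < P.b i
  γ_nonneg : 0 ≤ P.γ
  γ_lt : P.γ < 1
  cost : P.c < P.b 1

/-- No link can be added profitably to a balanced 2-star with at most `σ` nodes. -/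
structure Params.Saturated (P : Params) (σ : ℕ) : Prop where
  same : P.b 1 - P.c ≤ (1 - P.γ) * P.b 2
  leaves : 3 ≤ σ → P.b 1 - P.c ≤ P.b 3 - P.γ * (P.b 2 + P.b 3)
  center : ∀ q : ℕ, 3 ≤ σ → 2 * q ≤ σ + 1 →
    P.b 1 - P.c - (1 - P.γ) * P.b 2 + ((q : ℝ) - 1) * (P.γ * (2 * P.b 2 - P.b 3)) < 0

section Stability

variable {V : Type*} [Fintype V] {P : Params} {G : SimpleGraph V} {h : V → V} {A B : V} {σ : ℕ}

theorem IsHub.two_le_fiberCard (H : IsHub G h A B) {x : V} (hx : h x = A) (hxA : x ≠ A) :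
    2 ≤ fiberCard h A := by
  classical
  rw [fiberCard, ← card_pair hxA]
  refine card_le_card fun v hv => ?_
  simp only [mem_insert, mem_singleton] at hv
  obtain rfl | rfl := hv
  · simpa using hx
  · simpa using H.left

theorem IsHub.utility_deleteLink_le (H : IsHub G h A B) (hP : P.Regular) (i j k : V) :
    utility P (deleteLink G i j) k ≤ utility P G k :=
  utility_le_of_acyclic hP.nonneg hP.γ_nonneg hP.γ_lt.le hP.cost.le H.isAcyclic
    (SimpleGraph.Hom.ofLE (SimpleGraph.deleteEdges_le _)) Function.injective_id k

theorem IsHub.center_lt (H : IsHub G h A B) (hP : P.Regular) (hS : P.Saturated σ)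
    (hB : fiberCard h B ≤ fiberCard h A + 1) (hσ : Fintype.card V ≤ σ) {x : V} (hx : h x = A)
    (hxA : x ≠ A) : utility P (addLink G B x) B < utility P G B := by
  have h1 := H.two_le_fiberCard hx hxA
  have h2 := H.fiberCard_add
  have h3 := H.symm.fiberCard_pos
  exact H.utility_addLink_center hP.nonneg hP.decay hP.γ_nonneg
    (hS.center _ (by omega) (by omega)) hx hxA

/-- Of two unlinked nodes of a balanced 2-star, one does not want the link. -/
theorem IsHub.addLink_le_or_lt (H : IsHub G h A B) (hP : P.Regular) (hS : P.Saturated σ)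
    (hA : fiberCard h A ≤ fiberCard h B + 1) (hB : fiberCard h B ≤ fiberCard h A + 1)
    (hσ : Fintype.card V ≤ σ) {i j : V} (hij : i ≠ j) (hadj : ¬ G.Adj i j) :
    utility P (addLink G i j) i ≤ utility P G i ∨
      utility P (addLink G i j) j < utility P G j := by
  have center : ∀ {i j}, i ≠ j → ¬ G.Adj i j → h i = i →
      utility P (addLink G i j) i < utility P G i := by
    intro i j hij hadj hi
    have hj : h j ≠ j := by
      intro hj
      have := H.adj_hub_hub (v := i) (w := j) (by rwa [hi, hj])
      rw [hi, hj] at this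
      exact hadj this
    have hji : h j ≠ i := fun e => hadj (e ▸ (H.adj_hub hj).symm)
    rcases H.eq_of_fixed hi with rfl | rfl
    · have hj' := (H.hub j).resolve_left hji
      exact H.symm.center_lt hP hS hA hσ hj' (hj' ▸ hj.symm)
    · have hj' := (H.hub j).resolve_right hji
      exact H.center_lt hP hS hB hσ hj' (hj' ▸ hj.symm)
  by_cases hi : h i = i
  · exact .inl (center hij hadj hi).le
  by_cases hj : h j = j
  · right
    rw [addLink_comm]
    exact center hij.symm (fun e => hadj e.symm) hj
  left
  by_cases he : h i = h j
  · exact H.utility_addLink_same hS.same hij hi hj he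
  · refine H.utility_addLink_leaves hP.nonneg hP.γ_nonneg (hS.leaves ?_) hi hj he
    have h1 := H.two_le_fiberCard (x := i)
    have h2 := H.symm.two_le_fiberCard (x := i)
    have h3 := H.fiberCard_add
    have h4 := H.fiberCard_pos
    have h5 := H.symm.fiberCard_pos
    rcases H.hub i with e | e
    · have := h1 e fun e' => hi (by rw [e, e'])
      omega
    · have := h2 e fun e' => hi (by rw [e, e'])
      omega

theorem IsBalanced.pairwiseStable (H : IsBalanced G A B) (hP : P.Regular) (hS : P.Saturated σ)
    (hσ : Fintype.card V ≤ σ) : PairwiseStable P G := by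
  obtain ⟨h, H, h1, h2⟩ := H
  refine ⟨fun i j _ => H.utility_deleteLink_le hP i j i, fun i j hij hadj hlt => ?_⟩
  exact (H.addLink_le_or_lt hP hS (by omega) h2 hσ hij hadj).resolve_left hlt.not_ge

theorem IsBalanced.not_move (H : IsBalanced G A B) (hP : P.Regular) (hS : P.Saturated σ)
    (hσ : Fintype.card V ≤ σ) (G' : SimpleGraph V) : ¬ Move P G G' := by
  obtain ⟨h, H, h1, h2⟩ := H
  rintro ⟨j, hj, hlt, -⟩
  rcases hj with ⟨w, -, rfl⟩ | ⟨w, hjw, hadj, hw, rfl⟩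
  · exact hlt.not_ge (H.utility_deleteLink_le hP j w j)
  · rcases H.addLink_le_or_lt hP hS (by omega) h2 hσ hjw hadj with h3 | h3
    · exact hlt.not_ge h3
    · exact h3.not_ge hw

end Stability

section Entry

variable {n : ℕ} {P : Params} {G : SimpleGraph (Fin n)} {h : Fin n → Fin n} {A B t : Fin n}

theorem accepts_of_isAcyclic (hP : P.Regular) (hG : (enter G t).IsAcyclic) : Accepts P G t :=
  utility_le_of_acyclic hP.nonneg hP.γ_nonneg hP.γ_lt.le hP.cost.le hG (enterHom G t)
    (Fin.castSucc_injective n) t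

theorem IsBalanced.enter (H : IsBalanced G A B) :
    IsBalanced (enter G A) B.castSucc A.castSucc := by
  obtain ⟨h, H, h1, h2⟩ := H
  have hne := H.ne
  refine ⟨_, H.enter.symm, ?_, ?_⟩ <;> rw [IsHub.fiberCard_enter, IsHub.fiberCard_enter] <;> simp [hne] <;>
    omega

theorem IsHub.entryUtility_center (H : IsHub G h A B) : entryUtility P G A =
    P.b 1 - P.c + (1 - P.γ) * (fiberCard h A * P.b 2 + (fiberCard h B - 1) * P.b 3)
      - P.c₀ * fiberCard h A := by
  rw [entryUtility_eq P H.connected, H.sum_center, H.linkCount_center]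

theorem IsHub.entryUtility_leaf (H : IsHub G h A B) (ht : h t = B) (ht' : t ≠ B) :
    entryUtility P G t = P.b 1 - P.c + (1 - P.γ) *
      (P.b 2 + (fiberCard h B - 1) * P.b 3 + (fiberCard h A - 1) * P.b 4) - P.c₀ := by
  rw [entryUtility_eq P H.connected, H.sum_leaf P.b ht ht',
    H.linkCount_leaf (ht ▸ ht'.symm : h t ≠ t)]
  push_cast
  ring

/-- In a path on three nodes, the two ends can exchange their roles. -/
theorem IsHub.isBalanced_of_path (H : IsHub G h A B) (hA : fiberCard h A = 1)
    (hB : fiberCard h B ≤ 2) (ht : h t = B) (ht' : t ≠ B) : IsBalanced G t B := by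
  classical
  have h1 : ∀ v, h v = A → v = A := by
    intro v hv
    by_contra hvA
    have := H.two_le_fiberCard hv hvA
    omega
  have h2 : ∀ v, h v = B → v = B ∨ v = t := by
    intro v hv
    by_contra hcon
    push Not at hcon
    have : ({v, B, t} : Finset (Fin n)).card ≤ fiberCard h B := by
      rw [fiberCard]
      refine card_le_card fun w hw => ?_
      simp only [mem_insert, mem_singleton] at hw
      obtain rfl | rfl | rfl := hw
      · simpa using hv
      · simpa using H.right
      · simpa using ht
    rw [card_eq_three.2 ⟨v, B, t, hcon.1, hcon.2, ht'.symm, rfl⟩] at this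
    omega
  have hne := H.ne
  have hAA := H.left
  have hBB := H.right
  have hall : ∀ v, v = A ∨ v = B ∨ v = t := fun v =>
    (H.hub v).elim (fun e => .inl (h1 v e)) fun e => .inr (h2 v e)
  have hAt : A ≠ t := by
    rintro rfl
    exact hne (hAA.symm.trans ht)
  have c1 : fiberCard (fun v => if v = t then t else B) t = 1 := by
    rw [← card_filter_eq_fiberCard, card_eq_one]
    refine ⟨t, ?_⟩
    ext v
    simp only [mem_filter, mem_univ, true_and, mem_singleton]
    grind
  have c2 : fiberCard (fun v => if v = t then t else B) B = 2 := by
    rw [← card_filter_eq_fiberCard, card_eq_two]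
    refine ⟨A, B, hne, ?_⟩
    ext v
    have := hall v
    simp only [mem_filter, mem_univ, true_and, mem_insert, mem_singleton]
    grind
  refine ⟨fun v => if v = t then t else B, ⟨ht', by simp, by simp [ht'.symm], ?_, ?_⟩, ?_, ?_⟩
  · intro v
    by_cases hv : v = t <;> simp [hv]
  · intro x y
    rw [H.adj]
    rcases hall x with rfl | rfl | rfl <;> rcases hall y with rfl | rfl | rfl <;>
      simp [*, Ne.symm, hne.symm, ht'.symm, hAt.symm]
  · omega
  · omega

/-- Entry through the smaller center is optimal, and every optimal entry is of this kind. -/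
theorem IsBalanced.entryUtility_lt_or_eq (H : IsBalanced G A B) (hP : P.Regular)
    (hc₀ : (1 - P.γ) * (P.b 2 - P.b 3) < P.c₀) (hc₀' : P.c₀ < (1 - P.γ) * (P.b 2 - P.b 4))
    (t : Fin n) : entryUtility P G t < entryUtility P G A ∨
      (entryUtility P G t = entryUtility P G A ∧ ∃ B', IsBalanced G t B') := by
  have H' := H
  obtain ⟨h, H, h1, h2⟩ := H
  have hγ : 0 < 1 - P.γ := by linarith [hP.γ_lt]
  have h34 : P.b 4 < P.b 3 := hP.decay 3 (by norm_num)
  have hA1 := H.fiberCard_pos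
  by_cases htA : t = A
  · subst htA
    exact .inr ⟨rfl, B, H'⟩
  by_cases htB : t = B
  · subst htB
    rw [H.entryUtility_center, H.symm.entryUtility_center]
    rcases h1.eq_or_lt with e | e
    · exact .inr ⟨by rw [e], A, h, H.symm, by omega, by omega⟩
    · left
      have e' : fiberCard h t = fiberCard h A + 1 := by omega
      rw [e']
      push_cast
      linarith
  rcases H.hub t with ht | ht
  · left
    have h3 := H.two_le_fiberCard ht htA
    rw [H.entryUtility_center, H.symm.entryUtility_leaf ht htA]
    have h3' : (2 : ℝ) ≤ fiberCard h A := by exact_mod_cast h3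
    have h1' : (fiberCard h A : ℝ) ≤ fiberCard h B := by exact_mod_cast h1
    have e1 : 0 < ((fiberCard h A : ℝ) - 1) * ((1 - P.γ) * (P.b 2 - P.b 4) - P.c₀) :=
      mul_pos (by linarith) (by linarith)
    have e2 : 0 ≤ (1 - P.γ) * (((fiberCard h B : ℝ) - fiberCard h A) * (P.b 3 - P.b 4)) :=
      mul_nonneg hγ.le (mul_nonneg (by linarith) (by linarith))
    linarith
  · rw [H.entryUtility_center, H.entryUtility_leaf ht htB]
    by_cases h3 : fiberCard h A = 1
    · right
      refine ⟨?_, B, H.isBalanced_of_path h3 (by omega) ht htB⟩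
      rw [h3]
      push_cast
      ring
    · left
      have h3' : (2 : ℝ) ≤ fiberCard h A := by exact_mod_cast (by omega : 2 ≤ fiberCard h A)
      have e1 : 0 < ((fiberCard h A : ℝ) - 1) * ((1 - P.γ) * (P.b 2 - P.b 4) - P.c₀) :=
        mul_pos (by linarith) (by linarith)
      linarith

theorem IsBalanced.entryChoice (H : IsBalanced G A B) (hP : P.Regular)
    (hc₀ : (1 - P.γ) * (P.b 2 - P.b 3) < P.c₀) (hc₀' : P.c₀ < (1 - P.γ) * (P.b 2 - P.b 4)) :
    EntryChoice P G A := by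
  refine ⟨?_, ?_, fun t _ => ?_⟩
  · obtain ⟨h, H, -⟩ := H.enter
    exact accepts_of_isAcyclic hP H.isAcyclic
  · obtain ⟨h, H, h1, h2⟩ := H
    rw [H.entryUtility_center]
    have hγ : 0 < 1 - P.γ := by linarith [hP.γ_lt]
    have h3 := hP.nonneg 3 (by norm_num)
    have h4 := hP.nonneg 4 (by norm_num)
    have hc := hP.cost
    have hB : (1 : ℝ) ≤ fiberCard h B := by exact_mod_cast H.symm.fiberCard_pos
    have e1 : 0 ≤ (fiberCard h A : ℝ) * ((1 - P.γ) * (P.b 2 - P.b 4) - P.c₀) :=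
      mul_nonneg (Nat.cast_nonneg _) (by linarith)
    have e2 : 0 ≤ (1 - P.γ) * ((fiberCard h A : ℝ) * P.b 4) := by positivity
    have e3 : 0 ≤ (1 - P.γ) * (((fiberCard h B : ℝ) - 1) * P.b 3) :=
      mul_nonneg hγ.le (mul_nonneg (by linarith) h3)
    linarith
  · exact (H.entryUtility_lt_or_eq hP hc₀ hc₀' t).elim le_of_lt fun h => h.1.le

theorem IsBalanced.enter_of_entryChoice (H : IsBalanced G A B) (hP : P.Regular)
    (hc₀ : (1 - P.γ) * (P.b 2 - P.b 3) < P.c₀) (hc₀' : P.c₀ < (1 - P.γ) * (P.b 2 - P.b 4))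
    (ht : EntryChoice P G t) : ∃ A' B', IsBalanced (NetworkFormation.enter G t) A' B' := by
  have hA := H.entryChoice hP hc₀ hc₀'
  rcases H.entryUtility_lt_or_eq hP hc₀ hc₀' t with h1 | ⟨-, B', h1⟩
  · exact absurd (ht.2.2 A hA.1) h1.not_ge
  · exact ⟨_, _, h1.enter⟩

end Entry

section Single

variable {P : Params}

theorem isBalanced_enter_bot (t : Fin 1) :
    IsBalanced (enter (⊥ : SimpleGraph (Fin 1)) t) t.castSucc (Fin.last 1) := by
  have hne : t.castSucc ≠ Fin.last 1 := (Fin.castSucc_lt_last t).ne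
  have hc : ∀ v : Fin 2, fiberCard id v = 1 := by
    intro v
    rw [← card_filter_eq_fiberCard]
    simp [filter_eq']
  refine ⟨id, ⟨hne, rfl, rfl, ?_, ?_⟩, by rw [hc, hc], by rw [hc, hc]; norm_num⟩
  · intro v
    induction v using Fin.lastCases with
    | last => exact .inr rfl
    | cast v => exact .inl (by rw [Subsingleton.elim v t]; rfl)
  · intro x y
    induction x using Fin.lastCases with
    | last =>
      induction y using Fin.lastCases with
      | last => simp
      | cast y =>
        rw [Subsingleton.elim y t, SimpleGraph.adj_comm, enter_adj_last]
        exact ⟨fun e => ⟨hne.symm, .inr (.inr (.inr ⟨rfl, rfl⟩))⟩, fun _ => rfl⟩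
    | cast x =>
      rw [Subsingleton.elim x t]
      induction y using Fin.lastCases with
      | last =>
        rw [enter_adj_last]
        exact ⟨fun e => ⟨hne, .inr (.inr (.inl ⟨rfl, rfl⟩))⟩, fun _ => rfl⟩
      | cast y =>
        rw [Subsingleton.elim y t]
        simp

theorem pairwiseStable_bot_one : PairwiseStable P (⊥ : SimpleGraph (Fin 1)) :=
  ⟨fun _ _ h => absurd h (by simp), fun i j h => absurd (Subsingleton.elim i j) h⟩

theorem entryChoice_bot_one (hP : P.Regular) (t : Fin 1) :
    EntryChoice P (⊥ : SimpleGraph (Fin 1)) t := by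
  refine ⟨?_, ?_, fun t' _ => by rw [Subsingleton.elim t' t]⟩
  · obtain ⟨h, H, -⟩ := isBalanced_enter_bot t
    exact accepts_of_isAcyclic hP H.isAcyclic
  · have : (⊥ : SimpleGraph (Fin 1)).Connected := ⟨fun v w => by rw [Subsingleton.elim v w]⟩
    have hl : linkCount (⊥ : SimpleGraph (Fin 1)) t = 0 := by simp [linkCount]
    rw [entryUtility_eq P this, hl, sum_eq_zero fun w _ => if_pos (Subsingleton.elim w t)]
    have := hP.cost
    norm_num
    exact this

end Single

section Formation

variable {P : Params} {σ : ℕ}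

theorem eq_or_isBalanced_of_formed (hP : P.Regular) (hS : P.Saturated σ)
    (hc₀ : (1 - P.γ) * (P.b 2 - P.b 3) < P.c₀) (hc₀' : P.c₀ < (1 - P.γ) * (P.b 2 - P.b 4))
    {n : ℕ} {G : SimpleGraph (Fin n)} (hG : Formed P n G) (hn : n ≤ σ) :
    n = 1 ∨ ∃ A B, IsBalanced G A B := by
  induction hG with
  | one => exact .inl rfl
  | @next n G t G' hG ht hmove _ ih =>
    right
    have hE : ∃ A B, IsBalanced (enter G t) A B := by
      rcases ih (by omega) with rfl | ⟨A, B, H⟩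
      · rw [Subsingleton.elim G ⊥]
        exact ⟨_, _, isBalanced_enter_bot t⟩
      · exact H.enter_of_entryChoice hP hc₀ hc₀' ht
    obtain ⟨A, B, H⟩ := hE
    rcases hmove.cases_head with rfl | ⟨G'', h1, -⟩
    · exact ⟨A, B, H⟩
    · exact absurd h1 (H.not_move hP hS (by simpa using hn) G'')

theorem exists_formed (hP : P.Regular) (hS : P.Saturated σ)
    (hc₀ : (1 - P.γ) * (P.b 2 - P.b 3) < P.c₀) (hc₀' : P.c₀ < (1 - P.γ) * (P.b 2 - P.b 4))
    {n : ℕ} (h1 : 1 ≤ n) (hn : n ≤ σ) : ∃ G, Formed P n G := by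
  induction n, h1 using Nat.le_induction with
  | base => exact ⟨⊥, .one⟩
  | succ n h1 ih =>
    obtain ⟨G, hG⟩ := ih (by omega)
    rcases eq_or_isBalanced_of_formed hP hS hc₀ hc₀' hG (by omega) with rfl | ⟨A, B, H⟩
    · have H := isBalanced_enter_bot 0
      rw [Subsingleton.elim G ⊥] at hG
      exact ⟨_, .next hG (entryChoice_bot_one hP 0) .refl
        (H.pairwiseStable hP hS (by simpa using hn))⟩
    · exact ⟨_, .next hG (H.entryChoice hP hc₀ hc₀') .refl
        (H.enter.pairwiseStable hP hS (by simpa using hn))⟩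

theorem saturated_of_regime (hP : P.Regular) (hσ : 1 ≤ σ) {lam : ℝ}
    (hlam : lam = (⌈(σ : ℝ) / 2 - 1⌉ : ℝ) * (2 * P.b 2 - P.b 3))
    (hregime :
      (P.γ < min ((P.b 2 - P.b 3) / (lam - P.b 3)) (P.b 3 / (P.b 2 + P.b 3)) ∧
        P.b 1 - P.b 3 + P.γ * (P.b 2 + P.b 3) ≤ P.c ∧ P.c < P.b 1) ∨
      ((P.b 2 - P.b 3) / (lam - P.b 3) ≤ P.γ ∧
        P.γ < min (P.b 2 / (lam + P.b 2)) (P.b 3 / (P.b 2 + P.b 3)) ∧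
        P.b 1 - P.b 2 + P.γ * P.b 2 + P.γ * lam < P.c ∧ P.c < P.b 1)) :
    P.Saturated σ := by
  have h23 : P.b 3 < P.b 2 := hP.decay 2 (by norm_num)
  have h3 := hP.nonneg 3 (by norm_num)
  have hγ := hP.γ_nonneg
  have hq : 0 < 2 * P.b 2 - P.b 3 := by linarith
  have hceil : ∀ k : ℤ, (k : ℝ) - 1 < (σ : ℝ) / 2 - 1 → (k : ℝ) * (2 * P.b 2 - P.b 3) ≤ lam := by
    intro k hk
    rw [hlam]
    refine mul_le_mul_of_nonneg_right ?_ hq.le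
    have : k - 1 < ⌈(σ : ℝ) / 2 - 1⌉ := by
      rw [Int.lt_ceil]
      push_cast
      exact hk
    exact_mod_cast (by omega : k ≤ ⌈(σ : ℝ) / 2 - 1⌉)
  have hlam₀ : 0 ≤ lam := by
    rw [hlam]
    refine mul_nonneg ?_ hq.le
    have : -1 < ⌈(σ : ℝ) / 2 - 1⌉ := by
      rw [Int.lt_ceil]
      push_cast
      have : (1 : ℝ) ≤ σ := by exact_mod_cast hσ
      linarith
    exact_mod_cast (by omega : 0 ≤ ⌈(σ : ℝ) / 2 - 1⌉)
  have hlam₁ : 3 ≤ σ → 0 < lam - P.b 3 := by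
    intro hσ
    have hσ' : (3 : ℝ) ≤ σ := by exact_mod_cast hσ
    have := hceil 1 (by push_cast; linarith)
    push_cast at this
    linarith
  have hcen : ∀ q : ℕ, 2 * q ≤ σ + 1 →
      ((q : ℝ) - 1) * (P.γ * (2 * P.b 2 - P.b 3)) ≤ P.γ * lam := by
    intro q hqσ
    have hqσ' : 2 * (q : ℝ) ≤ σ + 1 := by exact_mod_cast hqσ
    have := hceil (q - 1) (by push_cast; linarith)
    push_cast at this
    have := mul_le_mul_of_nonneg_left this hγ
    linarith
  have hγb : 0 ≤ P.γ * P.b 3 := mul_nonneg hγ h3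
  rcases hregime with ⟨h1, h2, -⟩ | ⟨h1, -, h2, -⟩
  · have h1' := (lt_min_iff.1 h1).1
    refine ⟨by linarith, fun _ => by linarith, fun q hσ hqσ => ?_⟩
    have h4 := (lt_div_iff₀ (hlam₁ hσ)).1 h1'
    have := hcen q hqσ
    linarith
  · have := mul_nonneg hγ hlam₀
    refine ⟨by linarith, fun hσ => ?_, fun q hσ hqσ => ?_⟩
    · have h4 := (div_le_iff₀ (hlam₁ hσ)).1 h1
      linarith
    · have := hcen q hqσ
      linarith

end Formation

end NetworkFormation

open NetworkFormation in
theorem mainTheorem4 (P : Params) (σ : ℕ) (lam : ℝ)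
    (hb_nonneg : ∀ i, 1 ≤ i → 0 ≤ P.b i)
    (hb_decay : ∀ i, 1 ≤ i → P.b (i + 1) < P.b i)
    (hγ₀ : 0 ≤ P.γ) (hγ₁ : P.γ < 1)
    (hlam : lam = (⌈(σ : ℝ) / 2 - 1⌉ : ℝ) * (2 * P.b 2 - P.b 3))
    (hc₀ : (1 - P.γ) * (P.b 2 - P.b 3) < P.c₀ ∧ P.c₀ < (1 - P.γ) * (P.b 2 - P.b 4))
    (hregime :
      (P.γ < min ((P.b 2 - P.b 3) / (lam - P.b 3)) (P.b 3 / (P.b 2 + P.b 3)) ∧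
        P.b 1 - P.b 3 + P.γ * (P.b 2 + P.b 3) ≤ P.c ∧ P.c < P.b 1) ∨
      ((P.b 2 - P.b 3) / (lam - P.b 3) ≤ P.γ ∧
        P.γ < min (P.b 2 / (lam + P.b 2)) (P.b 3 / (P.b 2 + P.b 3)) ∧
        P.b 1 - P.b 2 + P.γ * P.b 2 + P.γ * lam < P.c ∧ P.c < P.b 1)) :
    ∀ n : ℕ, 1 ≤ n → n ≤ σ →
      (∃ G, Formed P n G) ∧
      ∀ G, Formed P n G →
        PairwiseStable P G ∧ (2 ≤ n → IsTwoStar G) ∧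
        (n < σ →
          (∃ t, EntryChoice P G t) ∧
          ∀ t, EntryChoice P G t →
            ¬ ∃ f : ℕ → SimpleGraph (Fin (n + 1)),
              f 0 = enter G t ∧ ∀ k, Move P (f k) (f (k + 1))) := by
  have hP : P.Regular := ⟨hb_nonneg, hb_decay, hγ₀, hγ₁, hregime.elim (·.2.2) (·.2.2.2)⟩
  intro n hn hnσ
  have hS : P.Saturated σ := saturated_of_regime hP (hn.trans hnσ) hlam hregime
  refine ⟨exists_formed hP hS hc₀.1 hc₀.2 hn hnσ, fun G hG => ?_⟩
  have hterm : n < σ → ∀ {t : Fin n} {A B}, IsBalanced (enter G t) A B →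
      ¬ ∃ f : ℕ → SimpleGraph (Fin (n + 1)),
        f 0 = enter G t ∧ ∀ k, Move P (f k) (f (k + 1)) := by
    rintro hlt t A B H ⟨f, hf, hm⟩
    exact H.not_move hP hS (by simpa using hlt) (f 1) (hf ▸ hm 0)
  rcases eq_or_isBalanced_of_formed hP hS hc₀.1 hc₀.2 hG hnσ with rfl | ⟨A, B, H⟩
  · obtain rfl := Subsingleton.elim G ⊥
    exact ⟨pairwiseStable_bot_one, by omega, fun hlt =>
      ⟨⟨0, entryChoice_bot_one hP 0⟩, fun t _ => hterm hlt (isBalanced_enter_bot t)⟩⟩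
  · refine ⟨H.pairwiseStable hP hS (by simpa using hnσ), fun _ => H.isTwoStar, fun hlt =>
      ⟨⟨A, H.entryChoice hP hc₀.1 hc₀.2⟩, fun t ht => ?_⟩⟩
    obtain ⟨A', B', H'⟩ := H.enter_of_entryChoice hP hc₀.1 hc₀.2 ht
    exact hterm hlt H'
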